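/- **Setting.** Let $D\ge 3$ be an integer, and let $\mathbb V$ be a finite-dimensional vector space over the finite field $\mathbb F_q$ with a non-degenerate form of one of the following types, to which a scalar $e$ is attached: $C_D(q)$: $\dim\mathbb V=2D$, alternating, $e=1$; $B_D(q)$: $\dim\mathbb V=2D+1$, quadratic, $e=1$; $D_D(q)$: $\dim\mathbb V=2D$, quadratic of Witt index $D$, $e=0$; ${}^2D_{D+1}(q)$: $\dim\mathbb V=2D+2$, quadratic of Witt index $D$, $e=2$; ${}^2A_{2D}(r)$: $\dim\mathbb V=2D+1$, Hermitian, $q=r^2$, $e=\tfrac32$; ${}^2A_{2D-1}(r)$: $\dim\mathbb V=2D$, Hermitian, $q=r^2$, $e=\tfrac12$. Let $\Gamma$ be the dual polar graph of $\mathbb V$: its vertex set $X$ is the set of maximal isotropic subspaces, and $y,z\in X$ are adjacent iff $\dim(y\cap z)=D-1$. Let $\partial$ be its path-length distance, and let $x\in X$ be a vertex and $C$ a maximal clique of $\Gamma$ (under inclusion) with $x\in C$. Give $\mathbb C^X$ its standard Hermitian inner product; for $Y\subseteq X$ let $\hat Y$ be its characteristic vector, and $\hat x=\widehat{\{x\}}$.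 Let $M\subseteq\mathrm{Mat}_X(\mathbb C)$ be the Bose–Mesner algebra, generated by the distance matrices of $\Gamma$; put $M\hat x=\{m\hat x: m\in M\}$ and $M\hat C=\{m\hat C: m\in M\}$ (the primary modules of the Terwilliger algebras of $\Gamma$ with respect to $x$ and $C$). For $0\le i\le D-1$ put $$C_i=\{y\in X:\partial(y,C)=i\},\qquad C_i^-=\{y\in C_i:\partial(x,y)=i\},\qquad C_i^+=\{y\in C_i:\partial(x,y)=i+1\},$$ and let $\mathbf W\subseteq\mathbb C^X$ be the span of $\mathcal C=(\hat C_0^-,\hat C_0^+,\hat C_1^-,\hat C_1^+,\dots,\hat C_{D-1}^-,\hat C_{D-1}^+)$. Let $\kappa=q^{-e/2}$ and $\kappa'=\sqrt{-1}\,q^{-D/2}$. Let $\overline{\mathcal H}$ be the nil-DAHA of type $(C_1^\vee,C_1)$: the $\mathbb C$-algebra generated by $\mathcal T^{\pm1},\mathcal U,\mathcal X^{\pm1}$ with relations $$(\mathcal T-\kappa)(\mathcal T+\kappa^{-1})=0,\quad (\mathcal T'-\kappa')(\mathcal T'+\kappa'^{-1})=0,\quad \mathcal U(\mathcal U+1)=0,\quad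 \mathcal U'^2=0,$$ where $\mathcal T'=\mathcal X\mathcal T^{-1}$ and $\mathcal U'=\mathcal X^{-1}(\mathcal U+1)$. Define $2D\times 2D$ block diagonal matrices $$\mathfrak t=\mathrm{diag}(t(0),\dots,t(D-1)),\ \ \mathfrak u'=\mathrm{diag}(u'(0),\dots,u'(D-1)),\ \ \mathfrak t'=\mathrm{diag}(t'(0),\dots,t'(D)),\ \ \mathfrak u=\mathrm{diag}(u(0),\dots,u(D)),$$ and $\mathfrak x=\mathfrak t'\mathfrak t$, with blocks, for $0\le i\le D-1$, $$t(i)=\begin{pmatrix}q^{-e/2}-q^{e/2}&q^{e/2}\\ q^{-e/2}&0\end{pmatrix},\qquad u'(i)=\begin{pmatrix}0&0\\-\sqrt{-1}\,q^{(D-e)/2-i}&0\end{pmatrix},$$ for $1\le i\le D-1$, $$t'(i)=\sqrt{-1}\begin{pmatrix}q^{-D/2}(q^D-q^i+1)&q^{D/2}(q^{i-D}-1)\\ q^{-D/2}(1-q^i)&q^{i-D/2}\end{pmatrix},\qquad u(i)=\begin{pmatrix}-1&1-q^{D-i}\\0&0\end{pmatrix},$$ and the $1\times1$ blocks $t'(0)=t'(D)=(\sqrt{-1}\,q^{-D/2})$,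 $u(0)=(0)$, $u(D)=(-1)$. **Theorem.** The vectors in $\mathcal C$ are linearly independent, so $\mathcal C$ is an ordered basis of $\mathbf W$; the subspaces $M\hat x$ and $M\hat C$ are contained in $\mathbf W$; and there is a unique $\overline{\mathcal H}$-module structure on $\mathbf W$ for which $\mathfrak t,\mathfrak t',\mathfrak u,\mathfrak u',\mathfrak x$ are the matrices representing $\mathcal T,\mathcal T',\mathcal U,\mathcal U',\mathcal X$ in the ordered basis $\mathcal C$. For this module structure, let $\pi$ and $\widetilde\pi$ be the orthogonal projections from $\mathbf W$ onto $M\hat x$ and onto $M\hat C$, respectively. Then on $\mathbf W$ $$\pi=\frac{\mathcal T'+\kappa'^{-1}}{\kappa'+\kappa'^{-1}},\qquad \widetilde\pi=\frac{\mathcal T+\kappa^{-1}}{\kappa+\kappa^{-1}}.$$ -/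

import Mathlib

noncomputable section

namespace DualPolar

/-! ### Polar spaces and dual polar graphs -/

/-- A totally isotropic (totally singular) subspace for a quadratic form. -/
def QuadIsotropic {K V : Type*} [Field K] [AddCommGroup V] [Module K V]
    (Q : QuadraticForm K V) (U : Submodule K V) : Prop :=
  ∀ u ∈ U, Q u = 0

/-- The Witt index of `Q` is `D`: the largest dimension of a totally isotropic subspace is `D`. -/
def QuadHasWittIndex {K V : Type*} [Field K] [AddCommGroup V] [Module K V]
    (Q : QuadraticForm K V) (D : ℕ) : Prop :=
  IsGreatest {n : ℕ | ∃ U : Submodule K V, QuadIsotropic Q U ∧ Module.finrank K U = n} D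

/-- The six families of spaces `V` over the finite field `K` with `q = |K|` elements, equipped with
a non-degenerate form. In the Hermitian cases `q = r ^ 2` and the field automorphism `σ` is
`a ↦ a ^ r`. For quadratic forms `QuadraticMap.Nondegenerate` is the notion that is correct in every
characteristic. -/
inductive PolarSpace (K V : Type*) [Field K] [Fintype K] [AddCommGroup V] [Module K V] (D : ℕ)
  /-- `C_D(q)` -/
  | symplectic (B : LinearMap.BilinForm K V) (alt : B.IsAlt) (nondeg : B.Nondegenerate)
      (dim : Module.finrank K V = 2 * D)
  /-- `B_D(q)` -/
  | parabolic (Q : QuadraticForm K V) (nondeg : Q.Nondegenerate)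
      (dim : Module.finrank K V = 2 * D + 1)
  /-- `D_D(q)` -/
  | hyperbolic (Q : QuadraticForm K V) (nondeg : Q.Nondegenerate)
      (dim : Module.finrank K V = 2 * D) (witt : QuadHasWittIndex Q D)
  /-- `²D_{D+1}(q)` -/
  | elliptic (Q : QuadraticForm K V) (nondeg : Q.Nondegenerate)
      (dim : Module.finrank K V = 2 * D + 2) (witt : QuadHasWittIndex Q D)
  /-- `²A_{2D}(r)` -/
  | hermitianOdd (r : ℕ) (card : Fintype.card K = r ^ 2) (σ : K →+* K) (frob : ∀ a, σ a = a ^ r)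
      (H : V →ₛₗ[σ] V →ₗ[K] K) (herm : ∀ u v, H v u = σ (H u v)) (nondeg : H.Nondegenerate)
      (dim : Module.finrank K V = 2 * D + 1)
  /-- `²A_{2D-1}(r)` -/
  | hermitianEven (r : ℕ) (card : Fintype.card K = r ^ 2) (σ : K →+* K) (frob : ∀ a, σ a = a ^ r)
      (H : V →ₛₗ[σ] V →ₗ[K] K) (herm : ∀ u v, H v u = σ (H u v)) (nondeg : H.Nondegenerate)
      (dim : Module.finrank K V = 2 * D)

namespace PolarSpace

variable {K V : Type*} [Field K] [Fintype K] [AddCommGroup V] [Module K V] {D : ℕ}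

/-- The form vanishes completely on the subspace `U`. -/
def IsIsotropic : PolarSpace K V D → Submodule K V → Prop
  | symplectic B _ _ _, U => ∀ u ∈ U, ∀ v ∈ U, B u v = 0
  | parabolic Q _ _, U => QuadIsotropic Q U
  | hyperbolic Q _ _ _, U => QuadIsotropic Q U
  | elliptic Q _ _ _, U => QuadIsotropic Q U
  | hermitianOdd _ _ _ _ H _ _ _, U => ∀ u ∈ U, ∀ v ∈ U, H u v = 0
  | hermitianEven _ _ _ _ H _ _ _, U => ∀ u ∈ U, ∀ v ∈ U, H u v = 0

/-- The scalar `e` attached to the type of the polar space. -/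
def e : PolarSpace K V D → ℝ
  | symplectic _ _ _ _ => 1
  | parabolic _ _ _ => 1
  | hyperbolic _ _ _ _ => 0
  | elliptic _ _ _ _ => 2
  | hermitianOdd _ _ _ _ _ _ _ _ => 3 / 2
  | hermitianEven _ _ _ _ _ _ _ _ => 1 / 2

/-- The vertices: the maximal isotropic subspaces. -/
def Vertex (S : PolarSpace K V D) : Type _ :=
  {U : Submodule K V // Maximal S.IsIsotropic U}

instance (S : PolarSpace K V D) [Module.Finite K V] : Finite S.Vertex := by
  have : Finite V := Module.finite_of_finite K
  unfold Vertex
  infer_instance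

instance (S : PolarSpace K V D) [Module.Finite K V] : Fintype S.Vertex := Fintype.ofFinite _

instance (S : PolarSpace K V D) : DecidableEq S.Vertex := Classical.decEq _

/-- The dual polar graph: `y`, `z` are adjacent iff `dim (y ∩ z) = D - 1`. (As all vertices have
dimension `D`, the clause `y ≠ z` is automatic.) -/
def graph (S : PolarSpace K V D) : SimpleGraph S.Vertex where
  Adj y z := y ≠ z ∧ Module.finrank K ↥(y.1 ⊓ z.1) + 1 = D
  symm := ⟨fun y z h => ⟨h.1.symm, by rw [inf_comm]; exact h.2⟩⟩
  loopless := ⟨fun _ h => h.1 rfl⟩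

end PolarSpace

/-! ### The standard module, the Bose-Mesner algebra, and the module `W` -/

section Graph

variable {X : Type*} [Fintype X] [DecidableEq X] (Γ : SimpleGraph X)

/-- The characteristic vector of a set of vertices, in the standard module `ℂ^X` with its
Hermitian inner product. -/
def charVec (Y : Set X) : EuclideanSpace ℂ X :=
  WithLp.toLp 2 (Y.indicator 1)

open Classical in
/-- The `i`-th distance matrix. -/
def distMatrix (i : ℕ) : Matrix X X ℂ :=
  Matrix.of fun y z => if Γ.Reachable y z ∧ Γ.dist y z = i then 1 else 0

/-- The Bose-Mesner algebra `M`, generated by the distance matrices. -/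
def boseMesner : Subalgebra ℂ (Matrix X X ℂ) :=
  Algebra.adjoin ℂ (Set.range (distMatrix Γ))

/-- The subspace `M v = {m v | m ∈ M}` of the standard module. -/
def boseMesnerSpan (v : EuclideanSpace ℂ X) : Submodule ℂ (EuclideanSpace ℂ X) :=
  (Subalgebra.toSubmodule (boseMesner Γ)).map
    (LinearMap.applyₗ v ∘ₗ (Matrix.toEuclideanLin (𝕜 := ℂ) (m := X) (n := X)).toLinearMap)

/-- The sphere `Γ_i(x)`. -/
def sphere (x : X) (i : ℕ) : Set X :=
  {y | Γ.Reachable x y ∧ Γ.dist x y = i}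

/-- The distance neighbour `C_i` of `C`: the vertices whose distance to `C`, i.e. the least
distance to a member of `C`, is `i`. -/
def nbhd (C : Set X) (i : ℕ) : Set X :=
  {y | IsLeast {n : ℕ | ∃ z ∈ C, Γ.Reachable y z ∧ Γ.dist y z = n} i}

/-- The cells `C_i^-` (for `a = 0`) and `C_i^+` (for `a = 1`), that is
`C_i^- = Γ_i(x) ∩ C_i` and `C_i^+ = Γ_{i+1}(x) ∩ C_i`. -/
def cell (x : X) (C : Set X) {D : ℕ} (p : Fin D × Fin 2) : Set X :=
  sphere Γ x ((p.1 : ℕ) + (p.2 : ℕ)) ∩ nbhd Γ C p.1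

/-- `W`, the span of the characteristic vectors of the `2 D` cells. -/
def primaryW (x : X) (C : Set X) (D : ℕ) : Submodule ℂ (EuclideanSpace ℂ X) :=
  Submodule.span ℂ (Set.range fun p : Fin D × Fin 2 => charVec (cell Γ x C p))

/-- The ordered basis of `W`: in lexicographic order of the indices it is
`C_0^-, C_0^+, C_1^-, C_1^+, …, C_{D-1}^-, C_{D-1}^+`. -/
def cellVec (x : X) (C : Set X) (D : ℕ) (p : Fin D × Fin 2) : primaryW Γ x C D :=
  ⟨charVec (cell Γ x C p), Submodule.subset_span ⟨p, rfl⟩⟩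

end Graph

/-- For subspaces `U`, `W` with `U ≤ W`, the orthogonal projection from `W` onto `U`, as an
endomorphism of `W`: a vector of `W` is projected orthogonally onto `U`, and the result, which lies
in `U ≤ W`, is regarded as an element of `W` again (the projection onto `W` fixes it). See the two
lemmas below. -/
def orthProjOn {X : Type*} [Fintype X] (W U : Submodule ℂ (EuclideanSpace ℂ X)) : Module.End ℂ W :=
  W.orthogonalProjectionOnto.toLinearMap ∘ₗ U.starProjection.toLinearMap ∘ₗ W.subtype

theorem orthProjOn_of_mem {X : Type*} [Fintype X] {W U : Submodule ℂ (EuclideanSpace ℂ X)} (w : W)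
    (hw : (w : EuclideanSpace ℂ X) ∈ U) : orthProjOn W U w = w := by
  have h1 : U.starProjection (w : EuclideanSpace ℂ X) = w :=
    Submodule.starProjection_eq_self_iff.mpr hw
  simp [orthProjOn, h1]

theorem orthProjOn_of_orthogonal {X : Type*} [Fintype X] {W U : Submodule ℂ (EuclideanSpace ℂ X)} (w : W)
    (hw : (w : EuclideanSpace ℂ X) ∈ Uᗮ) : orthProjOn W U w = 0 := by
  have h1 : U.starProjection (w : EuclideanSpace ℂ X) = 0 :=
    (Submodule.starProjection_apply_eq_zero_iff (K := U)).mpr hw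
  simp [orthProjOn, h1]


/-! ### The nil-DAHA of type `(C₁^∨, C₁)` -/

/-- Names of the generators `𝒯`, `𝒯⁻¹`, `𝒰`, `𝒳`, `𝒳⁻¹`. -/
inductive Gen
  | T | Tinv | U | X | Xinv

/-- The free algebra on the generators. -/
abbrev Free : Type := FreeAlgebra ℂ Gen

/-- A generator, in the free algebra. -/
abbrev gen (g : Gen) : Free := FreeAlgebra.ι ℂ g

/-- A scalar, in the free algebra. -/
abbrev sc (c : ℂ) : Free := algebraMap ℂ Free c

/-- The defining relations of the nil-DAHA with parameters `κ`, `κ'` (here `k`, `k'`), where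
`𝒯' = 𝒳 𝒯⁻¹` and `𝒰' = 𝒳⁻¹ (𝒰 + 1)`. -/
inductive NilRel (k k' : ℂ) : Free → Free → Prop
  | T_inv : NilRel k k' (gen .T * gen .Tinv) 1
  | inv_T : NilRel k k' (gen .Tinv * gen .T) 1
  | X_inv : NilRel k k' (gen .X * gen .Xinv) 1
  | inv_X : NilRel k k' (gen .Xinv * gen .X) 1
  | hecke_T : NilRel k k' ((gen .T - sc k) * (gen .T + sc k⁻¹)) 0
  | hecke_T' : NilRel k k'
      ((gen .X * gen .Tinv - sc k') * (gen .X * gen .Tinv + sc k'⁻¹)) 0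
  | nil_U : NilRel k k' (gen .U * (gen .U + 1)) 0
  | nil_U' : NilRel k k' ((gen .Xinv * (gen .U + 1)) ^ 2) 0

/-- The nil-DAHA of type `(C₁^∨, C₁)`. -/
abbrev NilDAHA (k k' : ℂ) : Type := RingQuot (NilRel k k')

namespace NilDAHA

variable (k k' : ℂ)

/-- The images of the generators. -/
def of (g : Gen) : NilDAHA k k' := RingQuot.mkAlgHom ℂ (NilRel k k') (gen g)

/-- The generator `𝒯`. -/
def T : NilDAHA k k' := of k k' .T

/-- The generator `𝒰`. -/
def U : NilDAHA k k' := of k k' .U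

/-- The generator `𝒳`. -/
def X : NilDAHA k k' := of k k' .X

/-- `𝒯' = 𝒳 𝒯⁻¹`. -/
def T' : NilDAHA k k' := of k k' .X * of k k' .Tinv

/-- `𝒰' = 𝒳⁻¹ (𝒰 + 1)`. -/
def U' : NilDAHA k k' := of k k' .Xinv * (of k k' .U + 1)

end NilDAHA

/-! ### The action of the nil-DAHA on `W` -/

section Action

/-- The real power `q ^ a`, as a complex number. -/
def rp (q : ℕ) (a : ℝ) : ℂ := (((q : ℝ) ^ a : ℝ) : ℂ)

/-- `κ = q^{-e/2}`. -/
def kappa (q : ℕ) (e : ℝ) : ℂ := rp q (-e / 2)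

/-- `κ' = √-1 q^{-D/2}`. -/
def kappa' (q D : ℕ) : ℂ := Complex.I * rp q (-(D : ℝ) / 2)

/-- The blocks `t(i)`, which do not depend on `i`. -/
def tBlock (q : ℕ) (e : ℝ) : Matrix (Fin 2) (Fin 2) ℂ :=
  !![rp q (-e / 2) - rp q (e / 2), rp q (e / 2);
     rp q (-e / 2), 0]

/-- The blocks `u'(i)`, `0 ≤ i ≤ D - 1`. -/
def u'Block (q D : ℕ) (e : ℝ) (i : ℕ) : Matrix (Fin 2) (Fin 2) ℂ :=
  !![0, 0;
     -Complex.I * rp q (((D : ℝ) - e) / 2 - i), 0]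

/-- The blocks `t'(i)`, `1 ≤ i ≤ D - 1`. The `1 × 1` blocks `t'(0) = t'(D) = (√-1 q^{-D/2})` are
the lower right entry for `i = 0` and the upper left entry for `i = D`. -/
def t'Block (q D : ℕ) (i : ℕ) : Matrix (Fin 2) (Fin 2) ℂ :=
  Complex.I •
    !![rp q (-(D : ℝ) / 2) * (rp q D - rp q i + 1), rp q ((D : ℝ) / 2) * (rp q ((i : ℝ) - D) - 1);
       rp q (-(D : ℝ) / 2) * (1 - rp q i), rp q ((i : ℝ) - (D : ℝ) / 2)]

/-- The blocks `u(i)`, `1 ≤ i ≤ D - 1`. The `1 × 1` blocks `u(0) = (0)` and `u(D) = (-1)` are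
the lower right entry for `i = 0` and the upper left entry for `i = D`. -/
def uBlock (q D : ℕ) (i : ℕ) : Matrix (Fin 2) (Fin 2) ℂ :=
  !![-1, 1 - rp q ((D : ℝ) - i);
     0, 0]

/-- Block diagonal matrices with `D` blocks of size `2`; the `i`-th block acts on the pair
`(C_i^-, C_i^+)`. -/
def blockDiag (D : ℕ) (b : ℕ → Matrix (Fin 2) (Fin 2) ℂ) :
    Matrix (Fin D × Fin 2) (Fin D × Fin 2) ℂ :=
  Matrix.of fun p r => if p.1 = r.1 then b p.1 p.2 r.2 else 0

/-- Block diagonal matrices with blocks of sizes `1, 2, …, 2, 1`; the `i`-th block acts on the pair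
`(C_{i-1}^+, C_i^-)` for `1 ≤ i ≤ D - 1`, the `0`-th block (lower right entry of `b 0`) on `C_0^-`,
and the `D`-th block (upper left entry of `b D`) on `C_{D-1}^+`. The vector with index `(i, a)`
lies in block number `i + a`, at place `1 - a`. -/
def blockDiag' (D : ℕ) (b : ℕ → Matrix (Fin 2) (Fin 2) ℂ) :
    Matrix (Fin D × Fin 2) (Fin D × Fin 2) ℂ :=
  Matrix.of fun p r =>
    if (p.1 : ℕ) + (p.2 : ℕ) = (r.1 : ℕ) + (r.2 : ℕ) then
      b ((p.1 : ℕ) + (p.2 : ℕ)) p.2.rev r.2.rev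
    else 0

/-- The matrix representing `𝒯`. -/
def matT (q D : ℕ) (e : ℝ) : Matrix (Fin D × Fin 2) (Fin D × Fin 2) ℂ :=
  blockDiag D fun _ => tBlock q e

/-- The matrix representing `𝒯'`. -/
def matT' (q D : ℕ) : Matrix (Fin D × Fin 2) (Fin D × Fin 2) ℂ :=
  blockDiag' D (t'Block q D)

/-- The matrix representing `𝒰`. -/
def matU (q D : ℕ) : Matrix (Fin D × Fin 2) (Fin D × Fin 2) ℂ :=
  blockDiag' D (uBlock q D)

/-- The matrix representing `𝒰'`. -/
def matU' (q D : ℕ) (e : ℝ) : Matrix (Fin D × Fin 2) (Fin D × Fin 2) ℂ :=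
  blockDiag D (u'Block q D e)

/-- The matrix representing `𝒳`. -/
def matX (q D : ℕ) (e : ℝ) : Matrix (Fin D × Fin 2) (Fin D × Fin 2) ℂ :=
  matT' q D * matT q D e

/-- The endomorphism `f` is represented by the matrix `m` in the family `b`: the `j`-th column of
`m` holds the coefficients of `f (b j)`. -/
def RepresentedBy {ι E : Type*} [Fintype ι] [AddCommGroup E] [Module ℂ E]
    (b : ι → E) (f : Module.End ℂ E) (m : Matrix ι ι ℂ) : Prop :=
  ∀ j, f (b j) = ∑ i, m i j • b i

/-- `ρ` is the nil-DAHA-module structure on `E` in which `𝒯`, `𝒯'`, `𝒰`, `𝒰'`, `𝒳` are represented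
in the family `b` by the matrices above. -/
structure IsNilAction {q D : ℕ} {e : ℝ} {E : Type*} [AddCommGroup E] [Module ℂ E]
    (b : Fin D × Fin 2 → E)
    (ρ : NilDAHA (kappa q e) (kappa' q D) →ₐ[ℂ] Module.End ℂ E) : Prop where
  repr_T : RepresentedBy b (ρ (NilDAHA.T _ _)) (matT q D e)
  repr_T' : RepresentedBy b (ρ (NilDAHA.T' _ _)) (matT' q D)
  repr_U : RepresentedBy b (ρ (NilDAHA.U _ _)) (matU q D)
  repr_U' : RepresentedBy b (ρ (NilDAHA.U' _ _)) (matU' q D e)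
  repr_X : RepresentedBy b (ρ (NilDAHA.X _ _)) (matX q D e)

end Action

end DualPolar

end

noncomputable section

set_option linter.unusedSectionVars false

namespace DualPolar

/-! ### Powers of `q` -/

section Powers

variable {q : ℕ}

/-! The `2 D` cells are disjoint, so their characteristic vectors are orthogonal. The sphere of
radius `j` about `x` is the union of `C_{j-1}^+` and `C_j^-`, and the sphere vectors span `M x̂`.
The set `C_i` is the union of `C_i^-` and `C_i^+`, and the vectors of the `C_i` span `M Ĉ`. Both
primary modules are thus spanned by sums over a partition of the cells. The orthogonal projection
onto such a span sends a cell vector to the sum over its class, weighted by the share of the cell in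
the class (`orthProjOn_fibre_sum`). The theorem then says that these shares are the matrix entries
of `(𝒯' + κ'⁻¹)/(κ' + κ'⁻¹)` and of `(𝒯 + κ⁻¹)/(κ + κ⁻¹)`.

The shares follow from two facts about the graph. It is distance-regular with `c_i = (q^i - 1)/(q -
1)` and `b_i = N (q^D - q^i)/(q - 1)`, where `N = q^e` (`IsDualPolarLike`). Every vertex has a
unique nearest member in the clique, its gate, and the other `N` members are one step farther
(`IsGate`). The gate gives a recursion for the cell sizes (`card_gate_fibre`). The shares come out
as `(q^D - q^i)/(q^D - 1)` for `C_i^-` and `(q^{i+1} - 1)/(q^D - 1)` for `C_i^+` in their spheres,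
and as `1/(1 + N)` and `N/(1 + N)` in `C_i`.

Both facts are proved at once for the six families by counting isotropic vectors for a reflexive
form (`IsPolarForm`). The type enters only through the number `s` of isotropic vectors on certain
lines and through `n = dim V`, which give `N = s q^{n-2D}`. A neighbour of `y` is determined by any
of its vectors outside `y`, so neighbours are counted by vectors (`ncard_closer`, `ncard_isNbr_ge`).

The module structure is independent of the geometry: the relations of the nil-DAHA are identities
between `2 × 2` blocks, and `𝒯`, `𝒰`, `𝒳` determine the action (`exists_isNilAction`). -/

theorem rp_ne_zero (hq : 0 < q) (a : ℝ) : rp q a ≠ 0 := by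
  have : (0 : ℝ) < (q : ℝ) ^ a := Real.rpow_pos_of_pos (by exact_mod_cast hq) a
  unfold rp
  exact_mod_cast this.ne'

theorem rp_add (hq : 0 < q) (a b : ℝ) : rp q (a + b) = rp q a * rp q b := by
  unfold rp
  rw [Real.rpow_add (by exact_mod_cast hq)]
  push_cast
  rfl

theorem rp_neg (a : ℝ) : rp q (-a) = (rp q a)⁻¹ := by
  unfold rp
  rw [Real.rpow_neg (by positivity)]
  push_cast
  rfl

theorem rp_natCast (n : ℕ) : rp q n = (q : ℂ) ^ n := by
  unfold rp
  rw [Real.rpow_natCast]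
  push_cast
  rfl

theorem rp_sub (hq : 0 < q) (a b : ℝ) : rp q (a - b) = rp q a / rp q b := by
  rw [sub_eq_add_neg, rp_add hq, rp_neg, div_eq_mul_inv]

theorem rp_half_mul_self (hq : 0 < q) (a : ℝ) : rp q (a / 2) * rp q (a / 2) = rp q a := by
  rw [← rp_add hq, add_halves]

end Powers

/-! ### Block diagonal matrices -/

section Blocks

variable {D : ℕ}

theorem blockDiag_mul (b c : ℕ → Matrix (Fin 2) (Fin 2) ℂ) :
    blockDiag D b * blockDiag D c = blockDiag D fun i => b i * c i := by
  ext ⟨i, a⟩ ⟨j, d⟩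
  simp only [blockDiag, Matrix.mul_apply, Matrix.of_apply, Fintype.sum_prod_type]
  rw [Finset.sum_eq_single i]
  · by_cases h : i = j <;> simp [h]
  · intro k _ hk
    simp [hk.symm]
  · simp

theorem blockDiag_one : blockDiag D (fun _ => 1) = 1 := by
  ext ⟨i, a⟩ ⟨j, d⟩
  by_cases h : i = j <;> simp [blockDiag, Matrix.one_apply, h]

theorem blockDiag_add (b c : ℕ → Matrix (Fin 2) (Fin 2) ℂ) :
    blockDiag D b + blockDiag D c = blockDiag D fun i => b i + c i := by
  ext ⟨i, a⟩ ⟨j, d⟩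
  by_cases h : i = j <;> simp [blockDiag, h]

theorem blockDiag_smul (r : ℂ) (b : ℕ → Matrix (Fin 2) (Fin 2) ℂ) :
    r • blockDiag D b = blockDiag D fun i => r • b i := by
  ext ⟨i, a⟩ ⟨j, d⟩
  by_cases h : i = j <;> simp [blockDiag, h]

theorem blockDiag'_one : blockDiag' D (fun _ => 1) = 1 := by
  ext ⟨⟨i, hi⟩, a⟩ ⟨⟨j, hj⟩, d⟩
  fin_cases a <;> fin_cases d <;> simp [blockDiag', Matrix.one_apply]

theorem blockDiag'_add (b c : ℕ → Matrix (Fin 2) (Fin 2) ℂ) :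
    blockDiag' D b + blockDiag' D c = blockDiag' D fun i => b i + c i := by
  ext p r
  by_cases h : (p.1 : ℕ) + (p.2 : ℕ) = (r.1 : ℕ) + (r.2 : ℕ) <;> simp [blockDiag', h]

theorem blockDiag'_smul (r : ℂ) (b : ℕ → Matrix (Fin 2) (Fin 2) ℂ) :
    r • blockDiag' D b = blockDiag' D fun i => r • b i := by
  ext p s
  by_cases h : (p.1 : ℕ) + (p.2 : ℕ) = (s.1 : ℕ) + (s.2 : ℕ) <;> simp [blockDiag', h]

/-- Level `k` contains only the indices `(k, 0)` and `(k - 1, 1)`; the first is missing for `k = D`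
and the second for `k = 0`. -/
theorem sum_add_eq (f : Fin D × Fin 2 → ℂ) (k : ℕ) :
    (∑ r : Fin D × Fin 2, if (r.1 : ℕ) + (r.2 : ℕ) = k then f r else 0) =
      (if h : k < D then f (⟨k, h⟩, 0) else 0) +
        (if h : 0 < k ∧ k - 1 < D then f (⟨k - 1, h.2⟩, 1) else 0) := by
  rw [Fintype.sum_prod_type]
  simp only [Fin.sum_univ_two, Finset.sum_add_distrib]
  congr 1
  · split_ifs with h
    · rw [Finset.sum_eq_single ⟨k, h⟩]
      · simp
      · intro j _ hj
        rw [if_neg]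
        intro h'
        exact hj (Fin.ext (by simpa using h'))
      · simp
    · refine Finset.sum_eq_zero fun j _ => if_neg ?_
      have := j.2
      simp only [Fin.val_zero]
      omega
  · split_ifs with h
    · rw [Finset.sum_eq_single ⟨k - 1, h.2⟩]
      · rw [if_pos]
        simp only [Fin.val_one]
        omega
      · intro j _ hj
        rw [if_neg]
        intro h'
        refine hj (Fin.ext ?_)
        simp only [Fin.val_one] at h' ⊢
        omega
      · simp
    · refine Finset.sum_eq_zero fun j _ => if_neg ?_
      have := j.2
      simp only [Fin.val_one]
      omega

/-- The end blocks keep only one entry of a `2 × 2` matrix. The two hypotheses kill the contribution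
of the absent index to that entry of the product, so that truncation commutes with multiplication.
-/
theorem blockDiag'_mul (b c : ℕ → Matrix (Fin 2) (Fin 2) ℂ) (h0 : b 0 1 0 = 0)
    (hD : b D 0 1 = 0) :
    blockDiag' D b * blockDiag' D c = blockDiag' D fun i => b i * c i := by
  ext p r
  rw [Matrix.mul_apply]
  have key : ∀ s : Fin D × Fin 2, blockDiag' D b p s * blockDiag' D c s r =
      if (s.1 : ℕ) + (s.2 : ℕ) = (p.1 : ℕ) + (p.2 : ℕ) then
        (if (p.1 : ℕ) + (p.2 : ℕ) = (r.1 : ℕ) + (r.2 : ℕ) then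
          b ((p.1 : ℕ) + (p.2 : ℕ)) p.2.rev s.2.rev * c ((p.1 : ℕ) + (p.2 : ℕ)) s.2.rev r.2.rev
          else 0) else 0 := by
    intro s
    simp only [blockDiag', Matrix.of_apply]
    by_cases h : (s.1 : ℕ) + (s.2 : ℕ) = (p.1 : ℕ) + (p.2 : ℕ)
    · simp [h]
    · simp [h, Ne.symm h]
  rw [Finset.sum_congr rfl fun s _ => key s, sum_add_eq]
  obtain ⟨⟨i, hi⟩, a⟩ := p
  by_cases h : i + (a : ℕ) = (r.1 : ℕ) + (r.2 : ℕ)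
  swap
  · simp [blockDiag', h]
  simp only [blockDiag', Matrix.of_apply, h, if_true, Matrix.mul_apply, Fin.sum_univ_two]
  rw [← h]
  have e0 : (0 : Fin 2).rev = 1 := rfl
  have e1 : (1 : Fin 2).rev = 0 := rfl
  simp only [e0, e1]
  fin_cases a
  · by_cases hi0 : i = 0
    · subst hi0
      simp [hi, e0, h0]
    · have h1 : 0 < i ∧ i - 1 < D := by omega
      simp [hi, h1, add_comm]
  · by_cases hi0 : i + 1 = D
    · subst hi0
      simp [e1, hD]
    · have h1 : i + 1 < D := by omega
      simp [hi, h1, add_comm]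

end Blocks

/-! ### The relations between the representing matrices -/

section Relations

variable {q D : ℕ} {e : ℝ}

theorem kappa_eq : kappa q e = (rp q (e / 2))⁻¹ := by
  rw [kappa, neg_div, rp_neg]

theorem kappa'_eq : kappa' q D = Complex.I * (rp q ((D : ℝ) / 2))⁻¹ := by
  rw [kappa', neg_div, rp_neg]

theorem kappa_ne_zero (hq : 0 < q) : kappa q e ≠ 0 := rp_ne_zero hq _

theorem kappa'_ne_zero (hq : 0 < q) : kappa' q D ≠ 0 :=
  mul_ne_zero Complex.I_ne_zero (rp_ne_zero hq _)

theorem tBlock_eq : tBlock q e =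
    !![(rp q (e / 2))⁻¹ - rp q (e / 2), rp q (e / 2); (rp q (e / 2))⁻¹, 0] := by
  rw [tBlock, neg_div, rp_neg]

theorem u'Block_eq (hq : 0 < q) (i : ℕ) : u'Block q D e i =
    !![0, 0; -Complex.I * (rp q ((D : ℝ) / 2) / (rp q (e / 2) * (q : ℂ) ^ i)), 0] := by
  rw [u'Block, sub_div, rp_sub hq, rp_sub hq, rp_natCast, div_div]

/-- All real powers are expressed by the single unit `q^{D/2}` and integral powers of `q`, so that
block identities become rational identities. -/
theorem t'Block_eq (hq : 0 < q) (i : ℕ) : t'Block q D i =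
    Complex.I •
      !![(rp q ((D : ℝ) / 2))⁻¹ * (rp q ((D : ℝ) / 2) ^ 2 - (q : ℂ) ^ i + 1),
        rp q ((D : ℝ) / 2) * ((q : ℂ) ^ i / rp q ((D : ℝ) / 2) ^ 2 - 1);
        (rp q ((D : ℝ) / 2))⁻¹ * (1 - (q : ℂ) ^ i), (q : ℂ) ^ i / rp q ((D : ℝ) / 2)] := by
  rw [t'Block, neg_div, rp_neg, rp_sub hq, rp_sub hq, rp_natCast i, sq, rp_half_mul_self hq]

theorem uBlock_eq (hq : 0 < q) (i : ℕ) : uBlock q D i =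
    !![-1, 1 - rp q ((D : ℝ) / 2) ^ 2 / (q : ℂ) ^ i; 0, 0] := by
  rw [uBlock, rp_sub hq, rp_natCast i, sq, rp_half_mul_self hq]

theorem tBlock_sq (hq : 0 < q) :
    tBlock q e * tBlock q e = (kappa q e - (kappa q e)⁻¹) • tBlock q e + (1 : ℂ) • 1 := by
  have h := rp_ne_zero hq (e / 2)
  rw [kappa_eq, tBlock_eq]
  ext i j
  fin_cases i <;> fin_cases j <;> simp [Matrix.mul_apply] <;> field_simp

theorem t'Block_sq (hq : 0 < q) (i : ℕ) :
    t'Block q D i * t'Block q D i =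
      (kappa' q D - (kappa' q D)⁻¹) • t'Block q D i + (1 : ℂ) • 1 := by
  have h := rp_ne_zero hq ((D : ℝ) / 2)
  have hI : Complex.I * Complex.I = -1 := Complex.I_mul_I
  rw [kappa'_eq, t'Block_eq hq]
  ext i j
  fin_cases i <;> fin_cases j <;>
    simp [Matrix.mul_apply] <;> field_simp <;> (try simp only [Complex.I_sq]) <;> ring

theorem uBlock_mul (hq : 0 < q) (i : ℕ) : uBlock q D i * (uBlock q D i + 1) = 0 := by
  rw [uBlock_eq hq]
  ext i j
  fin_cases i <;> fin_cases j <;> simp [Matrix.mul_apply]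

theorem u'Block_sq (hq : 0 < q) (i : ℕ) : u'Block q D e i * u'Block q D e i = 0 := by
  rw [u'Block_eq hq]
  ext i j
  fin_cases i <;> fin_cases j <;> simp [Matrix.mul_apply]

/-- The product is diagonal, hence can be regrouped from the blocks of `blockDiag` into those of
`blockDiag'`. This is the only link needed between the two block structures. -/
theorem tBlock_mul_u'Block (hq : 0 < q) (i : ℕ) : tBlock q e * u'Block q D e i =
    !![-Complex.I * rp q ((D : ℝ) / 2) / (q : ℂ) ^ i, 0; 0, 0] := by
  have h := rp_ne_zero hq (e / 2)
  rw [u'Block_eq hq, tBlock_eq]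
  ext i j
  fin_cases i <;> fin_cases j <;> simp [Matrix.mul_apply]
  field_simp

theorem t'Block_mul (hq : 0 < q) (i : ℕ) :
    t'Block q D i * !![0, 0; 0, -Complex.I * rp q ((D : ℝ) / 2) / (q : ℂ) ^ i] =
      uBlock q D i + 1 := by
  have h := rp_ne_zero hq ((D : ℝ) / 2)
  have h' : (q : ℂ) ^ i ≠ 0 := pow_ne_zero _ (by exact_mod_cast hq.ne')
  have hI : Complex.I * Complex.I = -1 := Complex.I_mul_I
  rw [t'Block_eq hq, uBlock_eq hq]
  ext i j
  fin_cases i <;> fin_cases j <;>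
    simp [Matrix.mul_apply] <;> field_simp <;> (try simp only [Complex.I_sq]) <;> ring

theorem t'Block_zero (hq : 0 < q) : t'Block q D 0 1 0 = 0 := by
  simp [t'Block_eq hq]

theorem t'Block_self (hq : 0 < q) : t'Block q D D 0 1 = 0 := by
  have h : (q : ℂ) ^ D ≠ 0 := pow_ne_zero _ (by exact_mod_cast hq.ne')
  simp [t'Block_eq hq, sq, rp_half_mul_self hq, rp_natCast, h]

theorem uBlock_self (hq : 0 < q) : uBlock q D D 0 1 = 0 := by
  have h : (q : ℂ) ^ D ≠ 0 := pow_ne_zero _ (by exact_mod_cast hq.ne')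
  simp [uBlock_eq hq, sq, rp_half_mul_self hq, rp_natCast, h]

theorem matT_sq (hq : 0 < q) :
    matT q D e * matT q D e = (kappa q e - (kappa q e)⁻¹) • matT q D e + 1 := by
  rw [matT, blockDiag_mul, ← blockDiag_one, blockDiag_smul, blockDiag_add]
  simp only [tBlock_sq hq, one_smul]

theorem matT'_sq (hq : 0 < q) :
    matT' q D * matT' q D = (kappa' q D - (kappa' q D)⁻¹) • matT' q D + 1 := by
  rw [matT', blockDiag'_mul _ _ (t'Block_zero hq) (t'Block_self hq), ← blockDiag'_one,
    blockDiag'_smul, blockDiag'_add]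
  simp only [t'Block_sq hq, one_smul]

theorem matU_mul (hq : 0 < q) : matU q D * (matU q D + 1) = 0 := by
  rw [matU, ← blockDiag'_one, blockDiag'_add, blockDiag'_mul _ _ rfl (uBlock_self hq)]
  simp only [uBlock_mul hq]
  ext p r
  simp [blockDiag']

theorem matU'_sq (hq : 0 < q) : matU' q D e * matU' q D e = 0 := by
  rw [matU', blockDiag_mul]
  simp only [u'Block_sq hq]
  ext p r
  simp [blockDiag]

/-- This is the definition `𝒰' = 𝒳⁻¹ (𝒰 + 1)` with the inverse cleared. -/
theorem matX_mul_matU' (hq : 0 < q) : matX q D e * matU' q D e = matU q D + 1 := by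
  have h : matT q D e * matU' q D e = blockDiag' D fun i =>
      !![0, 0; 0, -Complex.I * rp q ((D : ℝ) / 2) / (q : ℂ) ^ i] := by
    rw [matT, matU', blockDiag_mul]
    simp only [tBlock_mul_u'Block hq]
    ext ⟨⟨i, hi⟩, a⟩ ⟨⟨j, hj⟩, d⟩
    fin_cases a <;> fin_cases d <;> simp [blockDiag, blockDiag']
  rw [matX, mul_assoc, h, matT', matU,
    blockDiag'_mul _ _ (t'Block_zero hq) (t'Block_self hq), ← blockDiag'_one, blockDiag'_add]
  simp only [t'Block_mul hq]

end Relations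

/-! ### The action of the nil-DAHA in a basis -/

section Representation

theorem hecke_factor {A : Type*} [Ring A] [Algebra ℂ A] {k : ℂ} (hk : k ≠ 0) {t : A}
    (ht : t * t = (k - k⁻¹) • t + 1) :
    (t - algebraMap ℂ A k) * (t + algebraMap ℂ A k⁻¹) = 0 := by
  have h : algebraMap ℂ A k * algebraMap ℂ A k⁻¹ = 1 := by
    rw [← map_mul, mul_inv_cancel₀ hk, map_one]
  have h' : t * algebraMap ℂ A k⁻¹ = algebraMap ℂ A k⁻¹ * t := (Algebra.commutes _ _).symm
  rw [sub_mul, mul_add, mul_add, ht, h, h', ← Algebra.smul_def, ← Algebra.smul_def, sub_smul]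
  abel

/-- The quadratic relation alone supplies an inverse, so invertibility of the matrices needs no
separate argument. -/
theorem hecke_inv {A : Type*} [Ring A] [Algebra ℂ A] {k : ℂ} {t : A}
    (ht : t * t = (k - k⁻¹) • t + 1) :
    t * (t - (k - k⁻¹) • 1) = 1 ∧ (t - (k - k⁻¹) • 1) * t = 1 := by
  constructor
  · rw [mul_sub, ht, mul_smul_comm, mul_one]
    abel
  · rw [sub_mul, ht, smul_mul_assoc, one_mul]
    abel

/-- The assignment of endomorphisms to the generators extends to the nil-DAHA. -/
theorem exists_nilDAHA_hom {A : Type*} [Ring A] [Algebra ℂ A] {k k' : ℂ} (hk : k ≠ 0)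
    (hk' : k' ≠ 0) {t t' u u' : A} (ht : t * t = (k - k⁻¹) • t + 1)
    (ht' : t' * t' = (k' - k'⁻¹) • t' + 1) (hu : u * (u + 1) = 0) (hu' : u' * u' = 0)
    (hx : t' * t * u' = u + 1) :
    ∃ ρ : NilDAHA k k' →ₐ[ℂ] A, ρ (NilDAHA.T k k') = t ∧ ρ (NilDAHA.T' k k') = t' ∧
      ρ (NilDAHA.U k k') = u ∧ ρ (NilDAHA.U' k k') = u' ∧ ρ (NilDAHA.X k k') = t' * t := by
  obtain ⟨h1, h2⟩ := hecke_inv ht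
  obtain ⟨h3, h4⟩ := hecke_inv ht'
  set ti := t - (k - k⁻¹) • 1
  set ti' := t' - (k' - k'⁻¹) • 1
  have e1 : t' * t * ti = t' := by rw [mul_assoc, h1, mul_one]
  -- This turns the derived element `𝒳⁻¹ (𝒰 + 1)` into the prescribed `u'`; it is where `hx` enters.
  have e2 : ti * ti' * (u + 1) = u' := by
    rw [← hx, mul_assoc, mul_assoc t', ← mul_assoc ti', h4, one_mul, ← mul_assoc, h2, one_mul]
  let F : Free →ₐ[ℂ] A := FreeAlgebra.lift ℂ fun g => match g with
    | .T => t
    | .Tinv => ti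
    | .U => u
    | .X => t' * t
    | .Xinv => ti * ti'
  have fT : F (gen .T) = t := FreeAlgebra.lift_ι_apply _ _
  have fTi : F (gen .Tinv) = ti := FreeAlgebra.lift_ι_apply _ _
  have fU : F (gen .U) = u := FreeAlgebra.lift_ι_apply _ _
  have fX : F (gen .X) = t' * t := FreeAlgebra.lift_ι_apply _ _
  have fXi : F (gen .Xinv) = ti * ti' := FreeAlgebra.lift_ι_apply _ _
  have hF : ∀ ⦃a b : Free⦄, NilRel k k' a b → F a = F b := by
    intro a b hab
    induction hab with
    | T_inv => simp only [map_mul, map_one, fT, fTi, h1]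
    | inv_T => simp only [map_mul, map_one, fT, fTi, h2]
    | X_inv =>
      simp only [map_mul, map_one, fX, fXi]
      rw [← mul_assoc, e1, h3]
    | inv_X =>
      simp only [map_mul, map_one, fX, fXi]
      rw [mul_assoc, ← mul_assoc ti', h4, one_mul, h2]
    | hecke_T =>
      simp only [map_mul, map_sub, map_add, fT, AlgHom.commutes, map_zero]
      exact hecke_factor hk ht
    | hecke_T' =>
      simp only [map_mul, map_sub, map_add, fX, fTi, AlgHom.commutes, map_zero, e1]
      exact hecke_factor hk' ht'
    | nil_U => simp only [map_mul, map_add, map_one, fU, map_zero, hu]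
    | nil_U' => simp only [map_mul, map_add, map_one, fU, fXi, map_zero, e2, sq, hu']
  refine ⟨RingQuot.liftAlgHom ℂ ⟨F, hF⟩, ?_, ?_, ?_, ?_, ?_⟩ <;>
    simp only [NilDAHA.T, NilDAHA.T', NilDAHA.U, NilDAHA.U', NilDAHA.X, NilDAHA.of, map_mul,
      map_add, map_one, RingQuot.liftAlgHom_mkAlgHom_apply, fT, fTi, fU, fX, fXi, e1, e2]

theorem nilDAHA_inv (k k' : ℂ) :
    NilDAHA.of k k' .T * NilDAHA.of k k' .Tinv = 1 ∧
    NilDAHA.of k k' .Tinv * NilDAHA.of k k' .T = 1 ∧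
    NilDAHA.of k k' .X * NilDAHA.of k k' .Xinv = 1 ∧
    NilDAHA.of k k' .Xinv * NilDAHA.of k k' .X = 1 := by
  refine ⟨?_, ?_, ?_, ?_⟩ <;> rw [NilDAHA.of, NilDAHA.of, ← map_mul] <;>
    rw [← map_one (RingQuot.mkAlgHom ℂ (NilRel k k'))] <;>
    refine RingQuot.mkAlgHom_rel ℂ ?_
  exacts [.T_inv, .inv_T, .X_inv, .inv_X]

/-- A homomorphism is determined on the inverses by its values on `𝒯` and `𝒳`. -/
theorem nilDAHA_hom_ext {A : Type*} [Ring A] [Algebra ℂ A] {k k' : ℂ}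
    {ρ ρ' : NilDAHA k k' →ₐ[ℂ] A} (hT : ρ (NilDAHA.T k k') = ρ' (NilDAHA.T k k'))
    (hU : ρ (NilDAHA.U k k') = ρ' (NilDAHA.U k k'))
    (hX : ρ (NilDAHA.X k k') = ρ' (NilDAHA.X k k')) : ρ = ρ' := by
  obtain ⟨h1, h2, h3, h4⟩ := nilDAHA_inv k k'
  have hinv : ∀ {a b : NilDAHA k k'}, a * b = 1 → b * a = 1 → ρ a = ρ' a → ρ b = ρ' b := by
    intro a b hab hba h
    exact left_inv_eq_right_inv (by rw [← map_mul, hba, map_one])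
      (by rw [h, ← map_mul, hab, map_one])
  refine RingQuot.ringQuot_ext' ℂ ρ ρ' (FreeAlgebra.hom_ext (funext fun g => ?_))
  cases g with
  | T => exact hT
  | Tinv => exact hinv h1 h2 hT
  | U => exact hU
  | X => exact hX
  | Xinv => exact hinv h3 h4 hX

theorem representedBy_toLin {ι E : Type*} [Fintype ι] [DecidableEq ι] [AddCommGroup E]
    [Module ℂ E] (b : Module.Basis ι ℂ E) (m : Matrix ι ι ℂ) :
    RepresentedBy b (Matrix.toLinAlgEquiv b m) m := fun j => by
  rw [Matrix.toLinAlgEquiv_self]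

theorem RepresentedBy.unique {ι E : Type*} [Fintype ι] [AddCommGroup E]
    [Module ℂ E] (b : Module.Basis ι ℂ E) {m : Matrix ι ι ℂ} {f g : Module.End ℂ E}
    (hf : RepresentedBy b f m) (hg : RepresentedBy b g m) : f = g :=
  b.ext fun j => by rw [hf j, hg j]

theorem exists_isNilAction {q D : ℕ} (hq : 0 < q) (e : ℝ) {E : Type*} [AddCommGroup E]
    [Module ℂ E] (b : Module.Basis (Fin D × Fin 2) ℂ E) :
    ∃ ρ : NilDAHA (kappa q e) (kappa' q D) →ₐ[ℂ] Module.End ℂ E,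
      IsNilAction b ρ ∧ ∀ ρ', IsNilAction b ρ' → ρ' = ρ := by
  have hmap : ∀ {m n : Matrix (Fin D × Fin 2) (Fin D × Fin 2) ℂ}, m = n →
      Matrix.toLinAlgEquiv b m = Matrix.toLinAlgEquiv b n := fun h => by rw [h]
  have ht := hmap (matT_sq (D := D) (e := e) hq)
  have ht' := hmap (matT'_sq (D := D) hq)
  have hu := hmap (matU_mul (D := D) hq)
  have hu' := hmap (matU'_sq (D := D) (e := e) hq)
  have hx := hmap (matX_mul_matU' (D := D) (e := e) hq)
  simp only [matX, map_mul, map_add, map_smul, map_one, map_zero] at ht ht' hu hu' hx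
  obtain ⟨ρ, h1, h2, h3, h4, h5⟩ :=
    exists_nilDAHA_hom (kappa_ne_zero hq) (kappa'_ne_zero hq) ht ht' hu hu' hx
  have hρ : IsNilAction b ρ := by
    refine ⟨?_, ?_, ?_, ?_, ?_⟩
    · rw [h1]; exact representedBy_toLin b _
    · rw [h2]; exact representedBy_toLin b _
    · rw [h3]; exact representedBy_toLin b _
    · rw [h4]; exact representedBy_toLin b _
    · rw [h5, ← map_mul]; exact representedBy_toLin b _
  exact ⟨ρ, hρ, fun ρ' h => nilDAHA_hom_ext (h.repr_T.unique b hρ.repr_T)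
    (h.repr_U.unique b hρ.repr_U) (h.repr_X.unique b hρ.repr_X)⟩

end Representation

/-! ### Distance-regular graphs with dual polar intersection numbers -/

section Regular

variable {X : Type*} [Fintype X] [DecidableEq X]

/-- `Γ` is connected with diameter at most `D`, and has the intersection numbers
`c_i = (q ^ i - 1) / (q - 1)` and `b_i = N (q ^ D - q ^ i) / (q - 1)`. -/
structure IsDualPolarLike (Γ : SimpleGraph X) (D q N : ℕ) : Prop where
  two_le : 2 ≤ q
  one_le : 1 ≤ N
  connected : Γ.Connected
  dist_le : ∀ x y, Γ.dist x y ≤ D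
  closer : ∀ x y, ((q : ℂ) - 1) * ({z | Γ.Adj y z ∧ Γ.dist x z + 1 = Γ.dist x y} : Set X).ncard =
    (q : ℂ) ^ Γ.dist x y - 1
  farther : ∀ x y, ((q : ℂ) - 1) * ({z | Γ.Adj y z ∧ Γ.dist x z = Γ.dist x y + 1} : Set X).ncard =
    N * ((q : ℂ) ^ D - (q : ℂ) ^ Γ.dist x y)

theorem sum_ite_eq_ncard (P : X → Prop) [DecidablePred P] :
    (∑ z, if P z then (1 : ℂ) else 0) = ({z | P z} : Set X).ncard := by
  rw [Finset.sum_boole, Set.ncard_eq_toFinset_card', Set.toFinset_ofPred]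

theorem natCast_pow_sub_pow_ne_zero {q i j : ℕ} (hq : 2 ≤ q) (h : i < j) :
    (q : ℂ) ^ j - (q : ℂ) ^ i ≠ 0 := by
  rw [sub_ne_zero]
  exact_mod_cast (Nat.pow_lt_pow_right (by omega) h).ne'

theorem natCast_pow_sub_one_ne_zero {q j : ℕ} (hq : 2 ≤ q) (h : 0 < j) :
    (q : ℂ) ^ j - 1 ≠ 0 := by
  simpa using natCast_pow_sub_pow_ne_zero (i := 0) hq h

theorem natCast_sub_one_ne_zero {q : ℕ} (hq : 2 ≤ q) : (q : ℂ) - 1 ≠ 0 := by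
  simpa using natCast_pow_sub_one_ne_zero hq one_pos

/-- The intersection number `c_i`. -/
def interC (q i : ℕ) : ℂ := ((q : ℂ) ^ i - 1) / ((q : ℂ) - 1)

/-- The intersection number `b_i`. -/
def interB (D q N i : ℕ) : ℂ := N * ((q : ℂ) ^ D - (q : ℂ) ^ i) / ((q : ℂ) - 1)

/-- The intersection number `a_i`. -/
def interA (D q N i : ℕ) : ℂ := interB D q N 0 - interB D q N i - interC q i

theorem interC_ne_zero {q i : ℕ} (hq : 2 ≤ q) (hi : 0 < i) : interC q i ≠ 0 :=
  div_ne_zero (natCast_pow_sub_one_ne_zero hq hi) (natCast_sub_one_ne_zero hq)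

/-- The number of vertices at distance `i` from a given vertex. -/
def sphereCard (D q N : ℕ) : ℕ → ℂ
  | 0 => 1
  | i + 1 => sphereCard D q N i * interB D q N i / interC q (i + 1)

namespace IsDualPolarLike

variable {Γ : SimpleGraph X} {D q N : ℕ} (h : IsDualPolarLike Γ D q N)
include h

theorem dist_adj (x : X) {y z : X} (hyz : Γ.Adj y z) :
    Γ.dist x z = Γ.dist x y + 1 ∨ Γ.dist x z + 1 = Γ.dist x y ∨ Γ.dist x z = Γ.dist x y := by
  have h1 := h.connected.dist_triangle (u := x) (v := y) (w := z)
  have h2 := h.connected.dist_triangle (u := x) (v := z) (w := y)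
  rw [SimpleGraph.dist_comm (u := z)] at h2
  rw [SimpleGraph.dist_eq_one_iff_adj.mpr hyz] at h1 h2
  omega

open Classical in
theorem sum_closer (x y : X) :
    (∑ z, if Γ.Adj y z ∧ Γ.dist x z + 1 = Γ.dist x y then (1 : ℂ) else 0) =
      interC q (Γ.dist x y) := by
  rw [sum_ite_eq_ncard, interC, ← h.closer, mul_div_cancel_left₀ _
    (natCast_sub_one_ne_zero h.two_le)]

open Classical in
theorem sum_farther (x y : X) :
    (∑ z, if Γ.Adj y z ∧ Γ.dist x z = Γ.dist x y + 1 then (1 : ℂ) else 0) =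
      interB D q N (Γ.dist x y) := by
  rw [sum_ite_eq_ncard, interB, ← h.farther, mul_div_cancel_left₀ _
    (natCast_sub_one_ne_zero h.two_le)]

open Classical in
theorem sum_adj (y : X) : (∑ z, if Γ.Adj y z then (1 : ℂ) else 0) = interB D q N 0 := by
  have := h.sum_farther y y
  rw [SimpleGraph.dist_self] at this
  rw [← this]
  refine Finset.sum_congr rfl fun z _ => ?_
  simp

open Classical in
theorem sum_same (x y : X) :
    (∑ z, if Γ.Adj y z ∧ Γ.dist x z = Γ.dist x y then (1 : ℂ) else 0) =
      interA D q N (Γ.dist x y) := by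
  rw [interA, ← h.sum_adj y, ← h.sum_farther x y, ← h.sum_closer x y, ← Finset.sum_sub_distrib,
    ← Finset.sum_sub_distrib]
  refine Finset.sum_congr rfl fun z _ => ?_
  by_cases hz : Γ.Adj y z
  · rcases h.dist_adj x hz with h1 | h1 | h1
    · have : ¬ Γ.dist x y + 1 + 1 = Γ.dist x y := by omega
      simp [hz, h1, this]
    · rw [← h1]
      have : ¬ Γ.dist x z = Γ.dist x z + 1 + 1 := by omega
      simp [hz, this]
    · simp [hz, h1]
  · simp [hz]

/-! ### Distance matrices and the Bose–Mesner algebra -/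

theorem distMatrix_apply (i : ℕ) (y z : X) :
    distMatrix Γ i y z = if Γ.dist y z = i then 1 else 0 := by
  simp [distMatrix, h.connected.preconnected y z]

theorem distMatrix_zero : distMatrix Γ 0 = 1 := by
  ext y z
  rw [h.distMatrix_apply, Matrix.one_apply]
  simp [h.connected.dist_eq_zero_iff]

/-- A neighbour of `y` changes the distance to `x` by at most one, so only three distances
contribute, counted by `c_{i+2}`, `a_{i+1}` and `b_i`. -/
theorem distMatrix_one_mul (i : ℕ) : distMatrix Γ 1 * distMatrix Γ (i + 1) =
    interC q (i + 2) • distMatrix Γ (i + 2) + interA D q N (i + 1) • distMatrix Γ (i + 1) +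
      interB D q N i • distMatrix Γ i := by
  classical
  ext y x
  have e : (distMatrix Γ 1 * distMatrix Γ (i + 1)) y x =
      ∑ z, if Γ.Adj y z ∧ Γ.dist x z = i + 1 then (1 : ℂ) else 0 := by
    rw [Matrix.mul_apply]
    refine Finset.sum_congr rfl fun z _ => ?_
    rw [h.distMatrix_apply, h.distMatrix_apply, SimpleGraph.dist_comm (u := z)]
    simp only [SimpleGraph.dist_eq_one_iff_adj]
    by_cases hz : Γ.Adj y z <;> simp [hz]
  rw [e]
  simp only [Matrix.add_apply, Matrix.smul_apply, h.distMatrix_apply, smul_eq_mul]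
  rw [SimpleGraph.dist_comm (u := y)]
  by_cases h2 : Γ.dist x y = i + 2
  · have := h.sum_closer x y
    have e' : ∀ z, Γ.dist x z + 1 = i + 2 ↔ Γ.dist x z = i + 1 := fun z => by omega
    simp only [h2, e'] at this
    rw [this]
    simp [h2]
  by_cases h1 : Γ.dist x y = i + 1
  · have := h.sum_same x y
    rw [h1] at this
    rw [this]
    simp [h1]
  by_cases h0 : Γ.dist x y = i
  · have := h.sum_farther x y
    rw [h0] at this
    rw [this]
    simp [h0]
  · simp only [h2, h1, h0, if_false, mul_zero, add_zero]
    refine Finset.sum_eq_zero fun z _ => if_neg ?_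
    rintro ⟨hz, hx⟩
    rcases h.dist_adj x hz with h3 | h3 | h3 <;> omega

/-- The three-term recurrence can be solved for the highest matrix because `c_{i+2} ≠ 0`, even
beyond the diameter. -/
theorem distMatrix_mem_adjoin (i : ℕ) :
    distMatrix Γ i ∈ Algebra.adjoin ℂ {distMatrix Γ 1} := by
  induction i using Nat.twoStepInduction with
  | zero =>
    rw [h.distMatrix_zero]
    exact one_mem _
  | one => exact Algebra.subset_adjoin rfl
  | more i h1 h2 =>
    have e := h.distMatrix_one_mul i
    have e' : interC q (i + 2) • distMatrix Γ (i + 2) ∈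
        Algebra.adjoin ℂ {distMatrix Γ 1} := by
      have : interC q (i + 2) • distMatrix Γ (i + 2) =
          distMatrix Γ 1 * distMatrix Γ (i + 1) - interA D q N (i + 1) • distMatrix Γ (i + 1) -
            interB D q N i • distMatrix Γ i := by
        rw [e]; abel
      rw [this]
      exact sub_mem (sub_mem (mul_mem (Algebra.subset_adjoin rfl) h2)
        (Subalgebra.smul_mem _ h2 _)) (Subalgebra.smul_mem _ h1 _)
    have := Subalgebra.smul_mem _ e' (interC q (i + 2))⁻¹
    rwa [smul_smul, inv_mul_cancel₀ (interC_ne_zero h.two_le (by omega)), one_smul] at this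

/-- The Bose-Mesner algebra is spanned by the distance matrices. -/
theorem boseMesner_eq_span : Subalgebra.toSubmodule (boseMesner Γ) =
    Submodule.span ℂ (Set.range (distMatrix Γ)) := by
  refine le_antisymm ?_ (Submodule.span_le.mpr fun m hm => Algebra.subset_adjoin hm)
  set L := Submodule.span ℂ (Set.range (distMatrix Γ)) with hL
  have hmem : ∀ i, distMatrix Γ i ∈ L := fun i => Submodule.subset_span ⟨i, rfl⟩
  -- The recurrence makes the span stable under `A_1`, which generates the algebra; since the span
  -- contains `A_0 = 1`, it is the whole algebra.
  have h1 : ∀ l ∈ L, distMatrix Γ 1 * l ∈ L := by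
    intro l hl
    induction hl using Submodule.span_induction with
    | mem _ hx =>
      obtain ⟨i, rfl⟩ := hx
      cases i with
      | zero => rw [h.distMatrix_zero, mul_one]; exact hmem 1
      | succ i =>
        rw [h.distMatrix_one_mul]
        exact add_mem (add_mem (L.smul_mem _ (hmem _)) (L.smul_mem _ (hmem _)))
          (L.smul_mem _ (hmem _))
    | zero => rw [mul_zero]; exact zero_mem _
    | add _ _ _ _ ha hb => rw [mul_add]; exact add_mem ha hb
    | smul r _ _ ha => rw [mul_smul_comm]; exact L.smul_mem _ ha
  have h2 : ∀ m ∈ Algebra.adjoin ℂ {distMatrix Γ 1}, ∀ l ∈ L, m * l ∈ L := by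
    intro m hm
    induction hm using Algebra.adjoin_induction with
    | mem x hx => rw [hx]; exact h1
    | algebraMap r => intro l hl; rw [← Algebra.smul_def]; exact L.smul_mem _ hl
    | add _ _ _ _ ha hb => intro l hl; rw [add_mul]; exact add_mem (ha l hl) (hb l hl)
    | mul _ _ _ _ ha hb => intro l hl; rw [mul_assoc]; exact ha _ (hb l hl)
  have h3 : boseMesner Γ ≤ Algebra.adjoin ℂ {distMatrix Γ 1} := by
    refine Algebra.adjoin_le ?_
    rintro _ ⟨i, rfl⟩
    exact h.distMatrix_mem_adjoin i
  intro m hm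
  have := h2 m (h3 hm) 1 (by rw [← h.distMatrix_zero]; exact hmem 0)
  rwa [mul_one] at this

theorem boseMesnerSpan_eq (v : EuclideanSpace ℂ X) : boseMesnerSpan Γ v =
    Submodule.span ℂ (Set.range fun i => Matrix.toEuclideanLin (distMatrix Γ i) v) := by
  rw [boseMesnerSpan, h.boseMesner_eq_span, Submodule.map_span, ← Set.range_comp]
  rfl

/-! ### Sizes of the spheres -/

open Classical in
theorem sphereCard_eq (x : X) (i : ℕ) :
    (∑ y, if Γ.dist x y = i then (1 : ℂ) else 0) = sphereCard D q N i := by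
  induction i with
  | zero =>
    rw [sphereCard]
    simp [h.connected.dist_eq_zero_iff]
  | succ i ih =>
    rw [sphereCard, eq_div_iff (interC_ne_zero h.two_le (by omega)), ← ih, Finset.sum_mul,
      Finset.sum_mul]
    -- Double counting of the edges between the spheres of radius `i` and `i + 1`: `k_{i+1} c_{i+1}
    -- = k_i b_i`.
    have e1 : ∀ y, (if Γ.dist x y = i + 1 then (1 : ℂ) else 0) * interC q (i + 1) =
        ∑ z, if Γ.Adj y z ∧ Γ.dist x y = i + 1 ∧ Γ.dist x z = i then (1 : ℂ) else 0 := by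
      intro y
      by_cases hy : Γ.dist x y = i + 1
      · have := h.sum_closer x y
        simp only [hy, Nat.add_right_cancel_iff] at this
        simp [hy, ← this]
      · simp [hy]
    have e2 : ∀ y, (if Γ.dist x y = i then (1 : ℂ) else 0) * interB D q N i =
        ∑ z, if Γ.Adj z y ∧ Γ.dist x z = i + 1 ∧ Γ.dist x y = i then (1 : ℂ) else 0 := by
      intro y
      by_cases hy : Γ.dist x y = i
      · have := h.sum_farther x y
        rw [hy] at this
        simp only [hy, if_true, one_mul, and_true, ← this, SimpleGraph.adj_comm]
      · simp [hy]
    rw [Finset.sum_congr rfl fun y _ => e1 y, Finset.sum_congr rfl fun y _ => e2 y,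
      Finset.sum_comm]

theorem sphereCard_ne_zero {i : ℕ} (hi : i ≤ D) : sphereCard D q N i ≠ 0 := by
  induction i with
  | zero => simp [sphereCard]
  | succ i ih =>
    rw [sphereCard]
    refine div_ne_zero (mul_ne_zero (ih (by omega)) ?_) (interC_ne_zero h.two_le (by omega))
    have : (N : ℂ) ≠ 0 := by exact_mod_cast (Nat.one_le_iff_ne_zero.mp h.one_le)
    exact div_ne_zero (mul_ne_zero this (natCast_pow_sub_pow_ne_zero h.two_le (by omega)))
      (natCast_sub_one_ne_zero h.two_le)

end IsDualPolarLike

end Regular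

/-! ### Projections onto spans of sums over the classes of an orthogonal family -/

section Projection

theorem orthProjOn_eq_of_mem {X : Type*} [Fintype X] {W U : Submodule ℂ (EuclideanSpace ℂ X)}
    {w u : W} (hu : (u : EuclideanSpace ℂ X) ∈ U) (hw : (w - u : EuclideanSpace ℂ X) ∈ Uᗮ) :
    orthProjOn W U w = u := by
  have h1 := orthProjOn_of_mem u hu
  have h2 := orthProjOn_of_orthogonal (w - u) (U := U) (by simpa using hw)
  rw [map_sub, h1, sub_eq_zero] at h2
  exact h2

/-- If `v` is an orthogonal basis of `W`, and `U` is spanned by the sums of `v` over the fibres of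
`lev`, then the orthogonal projection onto `U` maps `v p` to a multiple of the sum over its
fibre. -/
theorem orthProjOn_fibre_sum {X ι κ : Type*} [Fintype X] [Fintype ι] [DecidableEq ι]
    [DecidableEq κ] {W : Submodule ℂ (EuclideanSpace ℂ X)} (b : ι → W) {n w : ι → ℂ} {lev : ι → κ}
    (hb : ∀ p r, inner ℂ (b p : EuclideanSpace ℂ X) (b r) = if p = r then n p else 0)
    (hw : ∀ p, n p = w p * ∑ r, if lev r = lev p then n r else 0) (p : ι) :
    orthProjOn W (Submodule.span ℂ (Set.range fun j => ∑ r, if lev r = j then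
      (b r : EuclideanSpace ℂ X) else 0)) (b p) = w p • ∑ r, if lev r = lev p then b r else 0 := by
  have hcoe : ((w p • ∑ r, if lev r = lev p then b r else 0 : W) : EuclideanSpace ℂ X) =
      w p • ∑ r, if lev r = lev p then (b r : EuclideanSpace ℂ X) else 0 := by
    rw [Submodule.coe_smul, Submodule.coe_sum]
    congr 1
    refine Finset.sum_congr rfl fun r _ => ?_
    split_ifs <;> simp
  apply orthProjOn_eq_of_mem
  · rw [hcoe]
    exact Submodule.smul_mem _ _ (Submodule.subset_span ⟨lev p, rfl⟩)
  -- The difference is orthogonal to the sums over other fibres by disjointness, and to the sum over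
  -- its own fibre by the choice of `w`.
  · rw [hcoe, Submodule.mem_orthogonal]
    intro u hu
    induction hu using Submodule.span_induction with
    | mem u hu =>
      obtain ⟨j, rfl⟩ := hu
      have h1 : ∀ r s, inner ℂ (if lev r = j then (b r : EuclideanSpace ℂ X) else 0) (b s) =
          if r = s then (if lev s = j then n s else 0) else 0 := by
        intro r s
        by_cases hrs : r = s
        · subst hrs
          by_cases hr : lev r = j
          · rw [if_pos hr, hb]
            simp [hr]
          · simp [hr]
        · by_cases hr : lev r = j
          · rw [if_pos hr, hb]
            simp [hrs]
          · simp [hr, hrs]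
      have h2 : ∀ s, inner ℂ (∑ r, if lev r = j then (b r : EuclideanSpace ℂ X) else 0) (b s) =
          if lev s = j then n s else 0 := by
        intro s
        rw [sum_inner, Finset.sum_congr rfl fun r _ => h1 r s]
        simp
      rw [inner_sub_right, inner_smul_right, inner_sum, h2]
      have h3 : ∀ s, inner ℂ (∑ r, if lev r = j then (b r : EuclideanSpace ℂ X) else 0)
          (if lev s = lev p then (b s : EuclideanSpace ℂ X) else 0) =
          if lev p = j then (if lev s = lev p then n s else 0) else 0 := by
        intro s
        by_cases hs : lev s = lev p
        · rw [if_pos hs, h2, hs]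
          simp
        · simp [hs]
      rw [Finset.sum_congr rfl fun s _ => h3 s]
      split_ifs
      · rw [← hw, sub_self]
      · simp
    | zero => simp
    | add _ _ _ _ h1 h2 => rw [inner_add_left, h1, h2, add_zero]
    | smul r _ _ h1 => rw [inner_smul_left, h1, mul_zero]

end Projection

/-! ### Cliques with gates, and the cells -/

section Gate

variable {X : Type*} [Fintype X] [DecidableEq X]

/-- `g y` is the unique member of `C` nearest to `y`; all other members of `C`, of which there
are `N`, are one step farther away. -/
structure IsGate (Γ : SimpleGraph X) (C : Set X) (g : X → X) (N : ℕ) : Prop where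
  ncard_eq : C.ncard = N + 1
  mem : ∀ y, g y ∈ C
  dist_eq : ∀ y, ∀ c ∈ C, c ≠ g y → Γ.dist y c = Γ.dist y (g y) + 1

variable {Γ : SimpleGraph X} {D q N : ℕ} {C : Set X} {g : X → X}

theorem charVec_apply (Y : Set X) [DecidablePred (· ∈ Y)] (y : X) :
    charVec Y y = if y ∈ Y then 1 else 0 := by
  simp [charVec, Set.indicator_apply]

/-- The clique has a second member, one step farther than the gate and still at distance at most
`D`. -/
theorem IsGate.dist_lt (h : IsDualPolarLike Γ D q N) (hg : IsGate Γ C g N) (y : X) :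
    Γ.dist y (g y) < D := by
  have h1 : 1 < C.ncard := by have := h.one_le; rw [hg.ncard_eq]; omega
  obtain ⟨c, hc, hne⟩ := Set.exists_ne_of_one_lt_ncard h1 (g y)
  have := hg.dist_eq y c hc hne
  have := h.dist_le y c
  omega

theorem IsGate.mem_nbhd (h : IsDualPolarLike Γ D q N) (hg : IsGate Γ C g N) (y : X) (j : ℕ) :
    y ∈ nbhd Γ C j ↔ Γ.dist y (g y) = j := by
  have hl : IsLeast {n : ℕ | ∃ z ∈ C, Γ.Reachable y z ∧ Γ.dist y z = n} (Γ.dist y (g y)) := by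
    refine ⟨⟨g y, hg.mem y, h.connected.preconnected _ _, rfl⟩, ?_⟩
    rintro _ ⟨z, hz, -, rfl⟩
    by_cases hzy : z = g y
    · rw [hzy]
    · rw [hg.dist_eq y z hz hzy]
      omega
  exact ⟨fun hj => hl.unique hj, fun hj => hj ▸ hl⟩

open Classical in
/-- The index of the cell containing `y`. -/
def cellIdx (h : IsDualPolarLike Γ D q N) (hg : IsGate Γ C g N) (x y : X) : Fin D × Fin 2 :=
  (⟨Γ.dist y (g y), hg.dist_lt h y⟩, if g y = x then 0 else 1)

theorem dist_eq_cellIdx (h : IsDualPolarLike Γ D q N) (hg : IsGate Γ C g N) {x : X} (hx : x ∈ C)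
    (y : X) : Γ.dist x y = (cellIdx h hg x y).1 + (cellIdx h hg x y).2 := by
  rw [SimpleGraph.dist_comm]
  by_cases hxy : g y = x
  · simp [cellIdx, hxy]
  · simp [cellIdx, hxy, hg.dist_eq y x hx (Ne.symm hxy)]

theorem mem_cell (h : IsDualPolarLike Γ D q N) (hg : IsGate Γ C g N) {x : X} (hx : x ∈ C)
    (y : X) (p : Fin D × Fin 2) : y ∈ cell Γ x C p ↔ cellIdx h hg x y = p := by
  have h1 : y ∈ cell Γ x C p ↔ Γ.dist x y = p.1 + p.2 ∧ Γ.dist y (g y) = p.1 := by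
    rw [cell, Set.mem_inter_iff, hg.mem_nbhd h]
    simp [sphere, h.connected.preconnected x y]
  have h2 : Γ.dist y (g y) = (cellIdx h hg x y).1 := rfl
  rw [h1, dist_eq_cellIdx h hg hx, h2, Prod.ext_iff, Fin.ext_iff, Fin.ext_iff]
  omega

open Classical in
theorem charVec_cell_apply (h : IsDualPolarLike Γ D q N) (hg : IsGate Γ C g N) {x : X}
    (hx : x ∈ C) (p : Fin D × Fin 2) (y : X) :
    charVec (cell Γ x C p) y = if cellIdx h hg x y = p then 1 else 0 := by
  rw [charVec_apply]
  simp only [mem_cell h hg hx]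

/-- The size of the cell with a given index. -/
def cellCard (h : IsDualPolarLike Γ D q N) (hg : IsGate Γ C g N) (x : X) (p : Fin D × Fin 2) : ℂ :=
  ∑ y, if cellIdx h hg x y = p then 1 else 0

theorem inner_charVec_cell (h : IsDualPolarLike Γ D q N) (hg : IsGate Γ C g N) {x : X}
    (hx : x ∈ C) (p r : Fin D × Fin 2) :
    inner ℂ (charVec (cell Γ x C p)) (charVec (cell Γ x C r)) =
      if p = r then cellCard h hg x p else 0 := by
  rw [PiLp.inner_apply]
  simp only [charVec_cell_apply h hg hx, RCLike.inner_apply]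
  by_cases hpr : p = r
  · subst hpr
    rw [if_pos rfl, cellCard]
    refine Finset.sum_congr rfl fun y _ => ?_
    by_cases hy : cellIdx h hg x y = p <;> simp [hy]
  · rw [if_neg hpr]
    refine Finset.sum_eq_zero fun y _ => ?_
    by_cases hy : cellIdx h hg x y = p
    · simp [hy, hpr]
    · simp [hy]

/-! ### Sizes of the cells -/

open Classical in
-- With `n_i` for the count, which does not depend on `c`, the split of the sphere about `c` by
-- gates reads `k_i = n_i + N n_{i-1}`. Together with the recursion for `k_i` this gives the closed
-- form by induction.
theorem card_gate_fibre (h : IsDualPolarLike Γ D q N) (hg : IsGate Γ C g N) (i : ℕ) {c : X}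
    (hc : c ∈ C) : (∑ y, if g y = c ∧ Γ.dist y c = i then (1 : ℂ) else 0) =
      sphereCard D q N i * (((q : ℂ) ^ D - (q : ℂ) ^ i) / ((q : ℂ) ^ D - 1)) := by
  by_cases hD0 : D = 0
  · have := hg.dist_lt h c
    omega
  have hD := natCast_pow_sub_one_ne_zero h.two_le (Nat.pos_of_ne_zero hD0)
  have hq1 := natCast_sub_one_ne_zero h.two_le
  -- A vertex at distance `i` from `c` either has gate `c`, or has another gate at distance `i - 1`;
  -- writing `dist + 1 = i` makes the second sum vanish for `i = 0`.
  have split : ∀ i, ∀ c ∈ C, sphereCard D q N i =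
      (∑ y, if g y = c ∧ Γ.dist y c = i then (1 : ℂ) else 0) +
        ∑ c' ∈ C.toFinset.erase c,
          ∑ y, if g y = c' ∧ Γ.dist y c' + 1 = i then (1 : ℂ) else 0 := by
    intro i c hc
    rw [← h.sphereCard_eq c, Finset.sum_comm, ← Finset.sum_add_distrib]
    refine Finset.sum_congr rfl fun y _ => ?_
    by_cases hy : g y = c
    · rw [Finset.sum_eq_zero, add_zero, SimpleGraph.dist_comm]
      · simp [hy]
      · intro c' hc'
        rw [if_neg]
        rintro ⟨h1, -⟩
        exact (Finset.mem_erase.mp hc').1 (h1.symm.trans hy)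
    · rw [Finset.sum_eq_single (g y)]
      · rw [SimpleGraph.dist_comm, hg.dist_eq y c hc (Ne.symm hy)]
        simp [hy]
      · intro c' _ hc'
        rw [if_neg]
        rintro ⟨h1, -⟩
        exact hc' h1.symm
      · intro h1
        exact absurd (Finset.mem_erase.mpr ⟨hy, by simpa using hg.mem y⟩) h1
  induction i generalizing c with
  | zero =>
    have := split 0 c hc
    simp only [Nat.add_eq_zero_iff, one_ne_zero, and_false, if_false, Finset.sum_const_zero,
      add_zero] at this
    rw [← this, pow_zero, div_self hD, mul_one]
  | succ i ih =>
    have e := split (i + 1) c hc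
    simp only [Nat.add_right_cancel_iff] at e
    have hcard : (C.toFinset.erase c).card = N := by
      rw [Finset.card_erase_of_mem (by simpa using hc), ← Set.ncard_eq_toFinset_card',
        hg.ncard_eq, Nat.add_sub_cancel]
    rw [Finset.sum_congr rfl fun c' hc' => ih (by
      simpa using (Finset.mem_erase.mp hc').2), Finset.sum_const, hcard, nsmul_eq_mul] at e
    replace e := eq_sub_of_add_eq e.symm
    have hc1 := natCast_pow_sub_one_ne_zero h.two_le (Nat.succ_pos i)
    -- The recursion `k_{i+1} c_{i+1} = k_i b_i` without denominators.
    have hs : sphereCard D q N (i + 1) * ((q : ℂ) ^ (i + 1) - 1) =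
        sphereCard D q N i * (N * ((q : ℂ) ^ D - (q : ℂ) ^ i)) := by
      rw [sphereCard, interB, interC]
      field_simp
    rw [e]
    field_simp
    linear_combination hs

theorem cellCard_zero (h : IsDualPolarLike Γ D q N) (hg : IsGate Γ C g N) {x : X} (hx : x ∈ C)
    (i : Fin D) : cellCard h hg x (i, 0) =
      sphereCard D q N i * (((q : ℂ) ^ D - (q : ℂ) ^ (i : ℕ)) / ((q : ℂ) ^ D - 1)) := by
  rw [← card_gate_fibre h hg i hx, cellCard]
  refine Finset.sum_congr rfl fun y _ => ?_
  congr 1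
  simp only [cellIdx, Prod.mk.injEq, Fin.ext_iff, eq_iff_iff]
  by_cases hy : g y = x <;> simp [hy]

open Classical in
theorem sphereCard_eq_sum_cellCard (h : IsDualPolarLike Γ D q N) (hg : IsGate Γ C g N) {x : X}
    (hx : x ∈ C) (j : ℕ) :
    (∑ r : Fin D × Fin 2, if (r.1 : ℕ) + (r.2 : ℕ) = j then cellCard h hg x r else 0) =
      sphereCard D q N j := by
  rw [← h.sphereCard_eq x j]
  simp only [cellCard]
  have : ∀ r : Fin D × Fin 2, (if (r.1 : ℕ) + (r.2 : ℕ) = j then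
      ∑ y, (if cellIdx h hg x y = r then (1 : ℂ) else 0) else 0) =
      ∑ y, if cellIdx h hg x y = r then (if Γ.dist x y = j then (1 : ℂ) else 0) else 0 := by
    intro r
    split_ifs with hr
    · refine Finset.sum_congr rfl fun y _ => ?_
      by_cases h1 : cellIdx h hg x y = r
      · rw [if_pos h1, if_pos h1, if_pos]
        rw [dist_eq_cellIdx h hg hx, h1, hr]
      · rw [if_neg h1, if_neg h1]
    · refine (Finset.sum_eq_zero fun y _ => ?_).symm
      split_ifs with h1 h2
      · rw [dist_eq_cellIdx h hg hx, h1] at h2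
        exact absurd h2 hr
      · rfl
      · rfl
  rw [Finset.sum_congr rfl fun r _ => this r, Finset.sum_comm]
  simp

/-- `C_i^+` is what remains of the sphere of radius `i + 1` after `C_{i+1}^-` is removed. -/
theorem cellCard_one (h : IsDualPolarLike Γ D q N) (hg : IsGate Γ C g N) {x : X} (hx : x ∈ C)
    (i : Fin D) : cellCard h hg x (i, 1) = sphereCard D q N (i + 1) *
      (((q : ℂ) ^ ((i : ℕ) + 1) - 1) / ((q : ℂ) ^ D - 1)) := by
  have hD := natCast_pow_sub_one_ne_zero h.two_le (Nat.pos_of_ne_zero (i.pos.ne'))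
  have e := sphereCard_eq_sum_cellCard h hg hx (i + 1)
  rw [sum_add_eq] at e
  have h2 : 0 < (i : ℕ) + 1 ∧ (i : ℕ) + 1 - 1 < D := by have := i.2; omega
  rw [dif_pos h2] at e
  simp only [Nat.add_sub_cancel, Fin.eta] at e
  rw [eq_sub_of_add_eq' e]
  split_ifs with h1
  · rw [cellCard_zero h hg hx]
    field_simp
    ring
  -- The sphere of radius `D` contains no cell of type `-`, so it equals `C_{D-1}^+`.
  · have : (i : ℕ) + 1 = D := by have := i.2; omega
    rw [this, div_self hD]
    ring

/-- The gate of a vertex of `C_i` is `x` or one of the `N` other members of the clique, each with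
equally many vertices. -/
theorem cellCard_one_eq_mul (h : IsDualPolarLike Γ D q N) (hg : IsGate Γ C g N) {x : X}
    (hx : x ∈ C) (i : Fin D) : cellCard h hg x (i, 1) = N * cellCard h hg x (i, 0) := by
  have hD := natCast_pow_sub_one_ne_zero h.two_le (Nat.pos_of_ne_zero (i.pos.ne'))
  have hq1 := natCast_sub_one_ne_zero h.two_le
  have hc1 := natCast_pow_sub_one_ne_zero h.two_le (Nat.succ_pos (i : ℕ))
  rw [cellCard_one h hg hx, cellCard_zero h hg hx, sphereCard, interB, interC]
  field_simp

theorem cellCard_ne_zero (h : IsDualPolarLike Γ D q N) (hg : IsGate Γ C g N) {x : X}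
    (hx : x ∈ C) (p : Fin D × Fin 2) : cellCard h hg x p ≠ 0 := by
  obtain ⟨i, a⟩ := p
  have h0 : cellCard h hg x (i, 0) ≠ 0 := by
    rw [cellCard_zero h hg hx]
    exact mul_ne_zero (h.sphereCard_ne_zero i.2.le)
      (div_ne_zero (natCast_pow_sub_pow_ne_zero h.two_le i.2)
        (natCast_pow_sub_one_ne_zero h.two_le (Nat.pos_of_ne_zero (i.pos.ne'))))
  have hN : (N : ℂ) ≠ 0 := by exact_mod_cast (Nat.one_le_iff_ne_zero.mp h.one_le)
  fin_cases a
  · exact h0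
  · exact (cellCard_one_eq_mul h hg hx i).trans_ne (mul_ne_zero hN h0)

/-! ### The ordered basis of cells -/

theorem linearIndependent_cellVec (h : IsDualPolarLike Γ D q N) (hg : IsGate Γ C g N) {x : X}
    (hx : x ∈ C) : LinearIndependent ℂ (cellVec Γ x C D) := by
  have hv : LinearIndependent ℂ fun p => charVec (cell Γ x C (D := D) p) := by
    refine linearIndependent_of_ne_zero_of_inner_eq_zero (fun p hp => ?_) fun p r hpr => ?_
    · have e := inner_charVec_cell h hg hx p p
      rw [hp, inner_zero_left, if_pos rfl] at e
      exact cellCard_ne_zero h hg hx p e.symm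
    · exact (inner_charVec_cell h hg hx p r).trans (if_neg hpr)
  exact LinearIndependent.of_comp (primaryW Γ x C D).subtype hv

theorem span_cellVec (Γ : SimpleGraph X) (x : X) (C : Set X) (D : ℕ) :
    Submodule.span ℂ (Set.range (cellVec Γ x C D)) = ⊤ := by
  apply Submodule.map_injective_of_injective (Submodule.injective_subtype _)
  rw [Submodule.map_subtype_top, Submodule.map_span, ← Set.range_comp]
  rfl

/-- The ordered basis of `W`. -/
def cellBasis (h : IsDualPolarLike Γ D q N) (hg : IsGate Γ C g N) {x : X} (hx : x ∈ C) :
    Module.Basis (Fin D × Fin 2) ℂ (primaryW Γ x C D) :=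
  Module.Basis.mk (linearIndependent_cellVec h hg hx) (span_cellVec Γ x C D).ge

theorem coe_cellBasis (h : IsDualPolarLike Γ D q N) (hg : IsGate Γ C g N) {x : X} (hx : x ∈ C) :
    ⇑(cellBasis h hg hx) = cellVec Γ x C D :=
  Module.Basis.coe_mk _ _

/-! ### The primary modules -/

theorem sum_cell_apply (h : IsDualPolarLike Γ D q N) (hg : IsGate Γ C g N) {x : X} (hx : x ∈ C)
    (lev : Fin D × Fin 2 → ℕ) (j : ℕ) (y : X) :
    (∑ r, if lev r = j then charVec (cell Γ x C r) else 0) y =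
      if lev (cellIdx h hg x y) = j then 1 else 0 := by
  rw [WithLp.ofLp_sum, Finset.sum_apply]
  rw [Finset.sum_eq_single (cellIdx h hg x y)]
  · split_ifs
    · rw [charVec_cell_apply h hg hx, if_pos rfl]
    · rfl
  · intro r _ hr
    split_ifs
    · rw [charVec_cell_apply h hg hx, if_neg (Ne.symm hr)]
    · rfl
  · simp

theorem distMatrix_charVec_singleton (h : IsDualPolarLike Γ D q N) (hg : IsGate Γ C g N) {x : X}
    (hx : x ∈ C) (j : ℕ) : Matrix.toEuclideanLin (distMatrix Γ j) (charVec {x}) =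
      ∑ r : Fin D × Fin 2,
        if (r.1 : ℕ) + (r.2 : ℕ) = j then charVec (cell Γ x C r) else 0 := by
  classical
  ext y
  rw [sum_cell_apply h hg hx (fun r => (r.1 : ℕ) + (r.2 : ℕ)), ← dist_eq_cellIdx h hg hx,
    Matrix.ofLp_toLpLin, Matrix.toLin'_apply, Matrix.mulVec, dotProduct]
  simp [charVec_apply, h.distMatrix_apply, SimpleGraph.dist_comm (u := y)]

/-- Entry `y` counts the members of `C` at distance `j` from `y`: the gate counts when `y ∈ C_j`,
and the other `N` members count when `y ∈ C_{j-1}`. -/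
theorem distMatrix_charVec_clique (h : IsDualPolarLike Γ D q N) (hg : IsGate Γ C g N) {x : X}
    (hx : x ∈ C) (j : ℕ) : Matrix.toEuclideanLin (distMatrix Γ j) (charVec C) =
      (∑ r : Fin D × Fin 2, if (r.1 : ℕ) = j then charVec (cell Γ x C r) else 0) +
        (N : ℂ) • ∑ r : Fin D × Fin 2,
          if (r.1 : ℕ) + 1 = j then charVec (cell Γ x C r) else 0 := by
  classical
  ext y
  rw [PiLp.add_apply, PiLp.smul_apply, sum_cell_apply h hg hx (fun r => (r.1 : ℕ)),
    sum_cell_apply h hg hx (fun r => (r.1 : ℕ) + 1),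
    Matrix.ofLp_toLpLin, Matrix.toLin'_apply, Matrix.mulVec, dotProduct]
  have e : ∀ c, distMatrix Γ j y c * charVec C c =
      (if c = g y then (if Γ.dist y (g y) = j then 1 else 0) else 0) +
      if c ∈ C.toFinset.erase (g y) then (if Γ.dist y (g y) + 1 = j then 1 else 0) else 0 := by
    intro c
    rw [h.distMatrix_apply, charVec_apply]
    by_cases hc : c = g y
    · subst hc
      simp [hg.mem]
    · by_cases hcC : c ∈ C
      · simp [hc, hcC, hg.dist_eq y c hcC hc]
      · simp [hc, hcC]
  have hcard : (C.toFinset.erase (g y)).card = N := by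
    rw [Finset.card_erase_of_mem (by simpa using hg.mem y), ← Set.ncard_eq_toFinset_card',
      hg.ncard_eq, Nat.add_sub_cancel]
  rw [Finset.sum_congr rfl fun c _ => e c, Finset.sum_add_distrib, Finset.sum_ite_eq',
    Finset.sum_ite_mem, Finset.univ_inter, Finset.sum_const, hcard]
  by_cases h1 : Γ.dist y (g y) + 1 = j <;> simp [cellIdx, h1] <;> congr

theorem boseMesnerSpan_singleton (h : IsDualPolarLike Γ D q N) (hg : IsGate Γ C g N) {x : X}
    (hx : x ∈ C) : boseMesnerSpan Γ (charVec {x}) =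
      Submodule.span ℂ (Set.range fun j : ℕ => ∑ r : Fin D × Fin 2,
        if (r.1 : ℕ) + (r.2 : ℕ) = j then charVec (cell Γ x C r) else 0) := by
  rw [h.boseMesnerSpan_eq]
  congr 2
  exact funext fun j => distMatrix_charVec_singleton h hg hx j

/-- The vectors `A_j Ĉ = Ĉ_j + N Ĉ_{j-1}` are a unitriangular transform of the `Ĉ_j`, so both
families have the same span. -/
theorem boseMesnerSpan_clique (h : IsDualPolarLike Γ D q N) (hg : IsGate Γ C g N) {x : X}
    (hx : x ∈ C) : boseMesnerSpan Γ (charVec C) =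
      Submodule.span ℂ (Set.range fun j : ℕ => ∑ r : Fin D × Fin 2,
        if (r.1 : ℕ) = j then charVec (cell Γ x C r) else 0) := by
  rw [h.boseMesnerSpan_eq]
  have e := distMatrix_charVec_clique h hg hx
  set s : ℕ → EuclideanSpace ℂ X := fun j => ∑ r : Fin D × Fin 2,
    if (r.1 : ℕ) = j then charVec (cell Γ x C r) else 0 with hs
  have e0 : Matrix.toEuclideanLin (distMatrix Γ 0) (charVec C) = s 0 := by
    rw [e]; simp [hs]
  have e1 : ∀ j, Matrix.toEuclideanLin (distMatrix Γ (j + 1)) (charVec C) =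
      s (j + 1) + (N : ℂ) • s j := by
    intro j
    rw [e]; simp [hs]
  apply le_antisymm
  · rw [Submodule.span_le]
    have hm : ∀ j, s j ∈ Submodule.span ℂ (Set.range s) := fun j => Submodule.subset_span ⟨j, rfl⟩
    rintro _ ⟨j, rfl⟩
    cases j with
    | zero =>
      simp only [e0]
      exact hm 0
    | succ j =>
      simp only [e1]
      exact add_mem (hm _) (Submodule.smul_mem _ _ (hm _))
  · rw [Submodule.span_le]
    rintro _ ⟨j, rfl⟩
    induction j with
    | zero => exact Submodule.subset_span ⟨0, e0⟩
    | succ j ih =>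
      rw [eq_sub_of_add_eq (e1 j).symm]
      exact sub_mem (Submodule.subset_span ⟨j + 1, rfl⟩) (Submodule.smul_mem _ _ ih)

theorem span_fibre_sum_le (x : X) (lev : Fin D × Fin 2 → ℕ) :
    Submodule.span ℂ (Set.range fun j : ℕ => ∑ r : Fin D × Fin 2,
      if lev r = j then charVec (cell Γ x C r) else 0) ≤ primaryW Γ x C D := by
  rw [Submodule.span_le]
  rintro _ ⟨j, rfl⟩
  refine Submodule.sum_mem _ fun r _ => ?_
  split_ifs
  · exact Submodule.subset_span ⟨r, rfl⟩
  · exact zero_mem _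

/-! ### The projections in terms of the generators -/

/-- Within a sphere, every entry of `t' + κ'⁻¹` in the column of a cell equals `κ' + κ'⁻¹` times the
share of that cell in the sphere; outside the sphere both sides have zero entries. -/
theorem orthProjOn_singleton (h : IsDualPolarLike Γ D q N) (hg : IsGate Γ C g N) {x : X}
    (hx : x ∈ C) {f : Module.End ℂ (primaryW Γ x C D)}
    (hf : RepresentedBy (cellVec Γ x C D) f (matT' q D)) :
    orthProjOn (primaryW Γ x C D) (boseMesnerSpan Γ (charVec {x})) =
      (kappa' q D + (kappa' q D)⁻¹)⁻¹ • (f + (kappa' q D)⁻¹ • LinearMap.id) := by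
  have hq : 0 < q := by have := h.two_le; omega
  have hD0 : 0 < D := lt_of_le_of_lt (Nat.zero_le _) (hg.dist_lt h x)
  have hD := natCast_pow_sub_one_ne_zero h.two_le hD0
  have ha := rp_ne_zero hq ((D : ℝ) / 2)
  have ha2 : rp q ((D : ℝ) / 2) ^ 2 = (q : ℂ) ^ D := by rw [sq, rp_half_mul_self hq, rp_natCast]
  have hk : kappa' q D + (kappa' q D)⁻¹ =
      -Complex.I * ((q : ℂ) ^ D - 1) / rp q ((D : ℝ) / 2) := by
    rw [kappa'_eq, ← ha2, mul_inv, Complex.inv_I, inv_inv]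
    field_simp
    ring
  have hk0 : kappa' q D + (kappa' q D)⁻¹ ≠ 0 := by
    rw [hk]
    exact div_ne_zero (mul_ne_zero (neg_ne_zero.mpr Complex.I_ne_zero) hD) ha
  refine (cellBasis h hg hx).ext fun p => ?_
  rw [coe_cellBasis, boseMesnerSpan_singleton h hg hx]
  -- The share of each cell in its sphere, read off from `cellCard_zero` and `cellCard_one`.
  let w : Fin D × Fin 2 → ℂ := fun p => if p.2 = 0 then
    ((q : ℂ) ^ D - (q : ℂ) ^ (p.1 : ℕ)) / ((q : ℂ) ^ D - 1) else
    ((q : ℂ) ^ ((p.1 : ℕ) + 1) - 1) / ((q : ℂ) ^ D - 1)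
  have key := orthProjOn_fibre_sum (cellVec Γ x C D) (n := cellCard h hg x) (w := w)
    (lev := fun r => (r.1 : ℕ) + (r.2 : ℕ)) (fun p r => inner_charVec_cell h hg hx p r)
    (fun p => by
      rw [sphereCard_eq_sum_cellCard h hg hx]
      obtain ⟨i, a⟩ := p
      fin_cases a
      · simpa [w, mul_comm] using cellCard_zero h hg hx i
      · simpa [w, mul_comm] using cellCard_one h hg hx i) p
  refine key.trans ?_
  rw [LinearMap.smul_apply, eq_inv_smul_iff₀ hk0, LinearMap.add_apply, hf p, LinearMap.smul_apply, LinearMap.id_apply,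
    Finset.smul_sum, Finset.smul_sum]
  -- The scalar term is expanded over the same index set, which allows a comparison coefficient by
  -- coefficient.
  have hp : (kappa' q D)⁻¹ • cellVec Γ x C D p =
      ∑ r, (if r = p then (kappa' q D)⁻¹ else 0) • cellVec Γ x C D r := by
    simp
  rw [hp, ← Finset.sum_add_distrib]
  refine Finset.sum_congr rfl fun r _ => ?_
  rw [← add_smul, matT', blockDiag']
  simp only [Matrix.of_apply]
  by_cases hrp : (r.1 : ℕ) + (r.2 : ℕ) = (p.1 : ℕ) + (p.2 : ℕ)
  · rw [if_pos hrp, if_pos hrp, smul_smul]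
    congr 1
    rw [hrp, t'Block_eq hq, hk, kappa'_eq, mul_inv, Complex.inv_I, inv_inv]
    rw [← ha2]
    rw [← ha2] at hD
    obtain ⟨⟨i, hi⟩, a⟩ := p
    obtain ⟨⟨j, hj⟩, d⟩ := r
    have e0 : (0 : Fin 2).rev = 1 := rfl
    have e1 : (1 : Fin 2).rev = 0 := rfl
    fin_cases a <;> fin_cases d <;> simp [w, e0, e1] at hrp ⊢
    · simp only [hrp, if_true]
      rw [← ha2]
      field_simp
      ring
    · rw [← ha2]
      field_simp
      ring
    · rw [← ha2]
      field_simp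
      ring
    · simp only [hrp, if_true]
      rw [← ha2]
      field_simp
      ring
  · have : r ≠ p := fun hh => hrp (by rw [hh])
    simp [hrp, this]

/-- The argument is that for the spheres, with the classes `C_i`. Since `κ⁻² = N`, each column of `t
+ κ⁻¹` is constant and proportional to `1` or `N`. -/
theorem orthProjOn_clique (h : IsDualPolarLike Γ D q N) (hg : IsGate Γ C g N) {x : X}
    (hx : x ∈ C) {e : ℝ} (hN : rp q e = N) {f : Module.End ℂ (primaryW Γ x C D)}
    (hf : RepresentedBy (cellVec Γ x C D) f (matT q D e)) :
    orthProjOn (primaryW Γ x C D) (boseMesnerSpan Γ (charVec C)) =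
      (kappa q e + (kappa q e)⁻¹)⁻¹ • (f + (kappa q e)⁻¹ • LinearMap.id) := by
  have hq : 0 < q := by have := h.two_le; omega
  have ha := rp_ne_zero hq (e / 2)
  have ha2 : rp q (e / 2) ^ 2 = (N : ℂ) := by rw [sq, rp_half_mul_self hq, hN]
  have hN1 : (1 + N : ℂ) ≠ 0 := by
    rw [add_comm]
    exact Nat.cast_add_one_ne_zero N
  have hk : kappa q e + (kappa q e)⁻¹ = (1 + N) / rp q (e / 2) := by
    rw [kappa_eq, ← ha2, inv_inv]
    field_simp
  have hk0 : kappa q e + (kappa q e)⁻¹ ≠ 0 := by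
    rw [hk]
    exact div_ne_zero hN1 ha
  refine (cellBasis h hg hx).ext fun p => ?_
  rw [coe_cellBasis, boseMesnerSpan_clique h hg hx]
  let w : Fin D × Fin 2 → ℂ := fun p => if p.2 = 0 then 1 / (1 + N) else N / (1 + N)
  have key := orthProjOn_fibre_sum (cellVec Γ x C D) (n := cellCard h hg x) (w := w)
    (lev := fun r => (r.1 : ℕ)) (fun p r => inner_charVec_cell h hg hx p r)
    (fun p => by
      have e1 : ∀ r : Fin D, (∑ a : Fin 2, if (r : ℕ) = (p.1 : ℕ) then cellCard h hg x (r, a)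
          else 0) = if r = p.1 then (1 + N) * cellCard h hg x (p.1, 0) else 0 := by
        intro r
        rw [Fin.sum_univ_two]
        by_cases hr : r = p.1
        · subst hr
          simp only [if_true, cellCard_one_eq_mul h hg hx]
          ring
        · simp [hr, Fin.val_inj]
      rw [Fintype.sum_prod_type, Finset.sum_congr rfl fun r _ => e1 r, Finset.sum_ite_eq',
        if_pos (Finset.mem_univ _)]
      obtain ⟨i, a⟩ := p
      fin_cases a
      · simp [w]
        field_simp
      · simp [w, cellCard_one_eq_mul h hg hx]
        field_simp) p
  refine key.trans ?_
  rw [LinearMap.smul_apply, eq_inv_smul_iff₀ hk0, LinearMap.add_apply, hf p, LinearMap.smul_apply, LinearMap.id_apply,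
    Finset.smul_sum, Finset.smul_sum]
  have hp : (kappa q e)⁻¹ • cellVec Γ x C D p =
      ∑ r, (if r = p then (kappa q e)⁻¹ else 0) • cellVec Γ x C D r := by
    simp
  rw [hp, ← Finset.sum_add_distrib]
  refine Finset.sum_congr rfl fun r _ => ?_
  rw [← add_smul, matT, blockDiag]
  simp only [Matrix.of_apply]
  by_cases hrp : r.1 = p.1
  · rw [if_pos hrp, if_pos (by rw [hrp]), smul_smul]
    congr 1
    rw [tBlock_eq, hk, kappa_eq, inv_inv]
    obtain ⟨i, a⟩ := p
    obtain ⟨j, d⟩ := r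
    obtain rfl : j = i := hrp
    fin_cases a <;> fin_cases d <;> simp [w] <;> field_simp
    · rw [← ha2]
    · rw [ha2]
  · have : r ≠ p := fun hh => hrp (by rw [hh])
    simp [hrp, this, Fin.val_inj]

end Gate

/-! ### Counting tools -/

section Counting

theorem ncard_eq_mul_of_fibres {α β : Type*} [Finite α] [Finite β] {A : Set α} {T : Set β}
    (f : α → β) {m : ℕ} (hf : ∀ a ∈ A, f a ∈ T)
    (hm : ∀ t ∈ T, ({a | a ∈ A ∧ f a = t} : Set α).ncard = m) : A.ncard = T.ncard * m := by
  classical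
  have := Fintype.ofFinite α
  have := Fintype.ofFinite β
  rw [Set.ncard_eq_toFinset_card' A, Set.ncard_eq_toFinset_card' T,
    Finset.card_eq_sum_card_fiberwise (f := f) (t := T.toFinset)
      (fun a ha => by simpa using hf a (by simpa using ha)), ← smul_eq_mul, ← Finset.sum_const]
  refine Finset.sum_congr rfl fun t ht => ?_
  rw [← hm t (by simpa using ht), Set.ncard_eq_toFinset_card']
  congr 1
  ext a
  simp

/-- This and the next lemma concern additive groups because `functional` is only semilinear. -/
theorem AddMonoidHom.natCard_ker_mul_natCard_range {G H : Type*} [AddCommGroup G]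
    [AddCommGroup H] (f : G →+ H) : Nat.card f.ker * Nat.card f.range = Nat.card G := by
  rw [AddSubgroup.card_eq_card_quotient_mul_card_addSubgroup f.ker, mul_comm,
    Nat.card_congr (QuotientAddGroup.quotientKerEquivRange f).toEquiv]

theorem AddMonoidHom.ncard_fibre {G H : Type*} [AddCommGroup G]
    [AddCommGroup H] (f : G →+ H) (a : G) :
    ({b | f b = f a} : Set G).ncard = Nat.card f.ker := by
  have : ({b | f b = f a} : Set G) = (fun k => a + k) '' (f.ker : Set G) := by
    ext b
    constructor
    · intro hb
      refine ⟨b - a, ?_, by simp⟩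
      have hb' : f b = f a := hb
      simp [AddMonoidHom.mem_ker, hb']
    · rintro ⟨k, hk, rfl⟩
      have hk' : f k = 0 := hk
      simp [hk']
  rw [this, Set.ncard_image_of_injective _ (add_right_injective a)]
  rfl

variable {K V : Type*} [Field K] [Fintype K] [AddCommGroup V] [Module K V] [Module.Finite K V]

theorem ncard_submodule (U : Submodule K V) :
    (U : Set V).ncard = Fintype.card K ^ Module.finrank K U := by
  rw [← Nat.card_eq_fintype_card, ← Module.natCard_eq_pow_finrank]
  rfl

theorem ncard_submodule_diff (U W : Submodule K V) :
    ((U : Set V) \ W).ncard + Fintype.card K ^ Module.finrank K ↥(U ⊓ W) =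
      Fintype.card K ^ Module.finrank K U := by
  have : Finite V := Module.finite_of_finite K
  rw [← ncard_submodule, ← ncard_submodule, Submodule.coe_inf, add_comm]
  exact Set.ncard_inter_add_ncard_sdiff_eq_ncard _ _ (Set.toFinite _)

end Counting

/-! ### Polar forms -/

section PolarForm

variable {K V : Type*} [Field K] [AddCommGroup V] [Module K V] {σ : K →+* K}

/-- The common features of alternating, quadratic and Hermitian forms: a reflexive sesquilinear
form `B` and a set `I` of isotropic vectors. On a line through `v` in the direction of an isotropic
vector that is not orthogonal to `v` there are `s` isotropic vectors. -/
structure IsPolarForm (B : V →ₛₗ[σ] V →ₗ[K] K) (I : V → Prop) (s : ℕ) : Prop where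
  refl : ∀ u v, B u v = 0 → B v u = 0
  zero : I 0
  self : ∀ u, I u → B u u = 0
  add_smul : ∀ u v, I u → I v → B u v = 0 → ∀ a : K, I (u + a • v)
  nondeg : ∀ u, I u → (∀ v, B v u = 0) → u = 0
  ncard_line : ∀ p v, I p → B v p ≠ 0 → ({a : K | I (v + a • p)} : Set K).ncard = s

/-- `U` is totally isotropic. -/
def Iso (B : V →ₛₗ[σ] V →ₗ[K] K) (I : V → Prop) (U : Submodule K V) : Prop :=
  ∀ u ∈ U, I u ∧ ∀ v ∈ U, B u v = 0

/-- The orthogonal complement of `U`. -/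
def perp (B : V →ₛₗ[σ] V →ₗ[K] K) (U : Submodule K V) : Submodule K V where
  carrier := {v | ∀ u ∈ U, B u v = 0}
  add_mem' ha hb u hu := by rw [map_add, ha u hu, hb u hu, add_zero]
  zero_mem' u _ := map_zero _
  smul_mem' c v hv u hu := by rw [map_smul, hv u hu, smul_zero]

variable {B : V →ₛₗ[σ] V →ₗ[K] K} {I : V → Prop} {s D : ℕ}

theorem Iso.mono {U W : Submodule K V} (hW : Iso B I W) (h : U ≤ W) : Iso B I U :=
  fun u hu => ⟨(hW u (h hu)).1, fun v hv => (hW u (h hu)).2 v (h hv)⟩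

theorem finrank_sup_span {U : Submodule K V} [Module.Finite K V] {v : V} (hv : v ∉ U) :
    Module.finrank K ↥(U ⊔ Submodule.span K {v}) = Module.finrank K U + 1 := by
  have hv0 : v ≠ 0 := fun h => hv (h ▸ U.zero_mem)
  have h1 := Submodule.finrank_sup_add_finrank_inf_eq U (Submodule.span K {v})
  have h2 : U ⊓ Submodule.span K {v} = ⊥ := by
    rw [← disjoint_iff, Submodule.disjoint_span_singleton' hv0]
    exact hv
  rw [h2, finrank_bot, finrank_span_singleton hv0] at h1
  exact h1

theorem mem_sup_span_singleton {U : Submodule K V} {v w : V} :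
    w ∈ U ⊔ Submodule.span K {v} ↔ ∃ u ∈ U, ∃ a : K, u + a • v = w := by
  simp [Submodule.mem_sup, Submodule.mem_span_singleton]

/-- The functional `B v` on `U`. -/
def functional (B : V →ₛₗ[σ] V →ₗ[K] K) (U : Submodule K V) : V →ₛₗ[σ] Module.Dual K U :=
  (LinearMap.domRestrict' U).comp B

theorem functional_apply (U : Submodule K V) (v : V) (u : U) : functional B U v u = B v u := rfl

namespace IsPolarForm

variable (h : IsPolarForm B I s)
include h

theorem iso_sup_span {U : Submodule K V} (hU : Iso B I U) {v : V} (hv : I v)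
    (hvU : v ∈ perp B U) : Iso B I (U ⊔ Submodule.span K {v}) := by
  intro w hw
  obtain ⟨u, hu, a, rfl⟩ := mem_sup_span_singleton.mp hw
  refine ⟨h.add_smul u v (hU u hu).1 hv (hvU u hu) a, fun w' hw' => ?_⟩
  obtain ⟨u', hu', a', rfl⟩ := mem_sup_span_singleton.mp hw'
  simp [(hU u hu).2 u' hu', hvU u hu, h.refl _ _ (hvU u' hu'), h.self v hv]

theorem mem_of_perp {M : Submodule K V} (hM : Maximal (Iso B I) M) {v : V} (hv : I v)
    (hvM : v ∈ perp B M) : v ∈ M :=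
  hM.le_of_ge (h.iso_sup_span hM.prop hv hvM) le_sup_left
    (Submodule.mem_sup_right (Submodule.mem_span_singleton_self v))

variable [Fintype K] [Module.Finite K V]

/-- A vector of `U` killed by all `B v` is isotropic and hence zero by `nondeg`, so the range has
trivial coannihilator. Nondegeneracy on isotropic vectors suffices, which matters in characteristic
2, where a polar form may have a radical. -/
theorem functional_surjective {U : Submodule K V} (hU : Iso B I U) :
    Function.Surjective (functional B U) := by
  have : RingHomSurjective σ := ⟨Finite.surjective_of_injective σ.injective⟩
  rw [← LinearMap.range_eq_top]
  have h1 : (LinearMap.range (functional B U)).dualCoannihilator = ⊥ := by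
    rw [eq_bot_iff]
    intro u hu
    rw [Submodule.mem_dualCoannihilator] at hu
    have := h.nondeg u (hU u u.2).1 fun v => hu _ ⟨v, rfl⟩
    exact Subtype.ext this
  rw [← Subspace.dualCoannihilator_dualAnnihilator_eq (W := LinearMap.range (functional B U)), h1,
    Submodule.dualAnnihilator_bot]

theorem natCard_ker_functional {U : Submodule K V} (hU : Iso B I U) :
    Nat.card (functional B U).toAddMonoidHom.ker * Fintype.card K ^ Module.finrank K U =
      Fintype.card K ^ Module.finrank K V := by
  have e := AddMonoidHom.natCard_ker_mul_natCard_range (functional B U).toAddMonoidHom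
  have hr : (functional B U).toAddMonoidHom.range = ⊤ := by
    rw [AddMonoidHom.range_eq_top]
    exact h.functional_surjective hU
  rw [hr, AddSubgroup.card_top, Module.natCard_eq_pow_finrank (K := K) (V := V),
    Module.natCard_eq_pow_finrank (K := K) (V := Module.Dual K U), Subspace.dual_finrank_eq,
    Nat.card_eq_fintype_card (α := K)] at e
  exact e

theorem coe_ker_functional (U : Submodule K V) :
    ((functional B U).toAddMonoidHom.ker : Set V) = perp B U := by
  ext v
  constructor
  · intro hv u hu
    have hv' : functional B U v = 0 := hv
    exact h.refl _ _ (by rw [← functional_apply U v ⟨u, hu⟩, hv']; rfl)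
  · intro hv
    exact LinearMap.ext fun u => h.refl _ _ (hv u u.2)

theorem finrank_perp_add {U : Submodule K V} (hU : Iso B I U) :
    Module.finrank K (perp B U) + Module.finrank K U = Module.finrank K V := by
  have e := h.natCard_ker_functional hU
  have e' : Nat.card (functional B U).toAddMonoidHom.ker =
      Fintype.card K ^ Module.finrank K (perp B U) := by
    rw [← ncard_submodule, ← h.coe_ker_functional]
    rfl
  rw [e', ← pow_add] at e
  exact Nat.pow_right_injective Fintype.one_lt_card e

/-- The map `W → U*` induced by `B` has kernel `W ⊓ perp B U` and takes values in the annihilator of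
`P`, of dimension `dim U - dim P`. -/
theorem finrank_add_le {P U W : Submodule K V} (hPU : P ≤ U)
    (hPW : ∀ w ∈ W, ∀ p ∈ P, B w p = 0) :
    Module.finrank K W + Module.finrank K P ≤
      Module.finrank K ↥(W ⊓ perp B U) + Module.finrank K U := by
  have : Finite V := Module.finite_of_finite K
  let f : W →+ Module.Dual K U := (functional B U).toAddMonoidHom.comp W.subtype.toAddMonoidHom
  let P' : Submodule K U := P.comap U.subtype
  have hP' : Module.finrank K P' = Module.finrank K P :=
    (Submodule.comapSubtypeEquivOfLe hPU).finrank_eq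
  have hann := Subspace.finrank_add_finrank_dualAnnihilator_eq P'
  have hrange : (f.range : Set (Module.Dual K U)) ⊆ P'.dualAnnihilator := by
    rintro _ ⟨w, rfl⟩
    rw [SetLike.mem_coe, Submodule.mem_dualAnnihilator]
    exact fun u hu => hPW w w.2 u hu
  have hker : Nat.card f.ker = Fintype.card K ^ Module.finrank K ↥(W ⊓ perp B U) := by
    rw [← ncard_submodule]
    have : ((W ⊓ perp B U : Submodule K V) : Set V) = W.subtype '' (f.ker : Set W) := by
      ext v
      rw [Submodule.coe_inf, ← h.coe_ker_functional]
      constructor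
      · rintro ⟨h1, h2⟩
        exact ⟨⟨v, h1⟩, h2, rfl⟩
      · rintro ⟨w, hw, rfl⟩
        exact ⟨w.2, hw⟩
    rw [this, Set.ncard_image_of_injective _ (Submodule.injective_subtype _)]
    rfl
  have : Finite (Module.Dual K U) := Module.finite_of_finite K
  have hle : Nat.card f.range ≤ Fintype.card K ^ Module.finrank K P'.dualAnnihilator := by
    rw [← ncard_submodule]
    exact Set.ncard_le_ncard hrange (Set.toFinite _)
  have e := AddMonoidHom.natCard_ker_mul_natCard_range f
  rw [hker, Module.natCard_eq_pow_finrank (K := K) (V := W), Nat.card_eq_fintype_card (α := K)] at e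
  have := Nat.mul_le_mul_left (Fintype.card K ^ Module.finrank K ↥(W ⊓ perp B U)) hle
  rw [e, ← pow_add, Nat.pow_le_pow_iff_right Fintype.one_lt_card] at this
  omega

theorem finrank_le_of_maximal {M W : Submodule K V} (hM : Maximal (Iso B I) M)
    (hW : Iso B I W) : Module.finrank K W ≤ Module.finrank K M := by
  have h1 := h.finrank_add_le (P := M ⊓ W) (U := M) (W := W) inf_le_left
    fun w hw p hp => (hW w hw).2 p hp.2
  -- By maximality, `M` contains every isotropic vector orthogonal to it, so the dimension of `M ⊓
  -- W` cancels from `h1`.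
  have h2 : W ⊓ perp B M ≤ M ⊓ W := fun w hw => ⟨h.mem_of_perp hM (hW w hw.1).1 hw.2, hw.1⟩
  have := Submodule.finrank_mono h2
  omega

theorem exists_maximal_ge {U : Submodule K V} (hU : Iso B I U) :
    ∃ M, U ≤ M ∧ Maximal (Iso B I) M := by
  have : Finite V := Module.finite_of_finite K
  exact (Set.toFinite {W | Iso B I W}).exists_le_maximal hU

/-- Vectors with a given nonzero functional on a maximal isotropic subspace. -/
theorem ncard_isotropic_functional {M : Submodule K V} (hM : Iso B I M)
    {f : Module.Dual K M} (hf : f ≠ 0) :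
    Fintype.card K * ({v | I v ∧ functional B M v = f} : Set V).ncard *
      Fintype.card K ^ Module.finrank K M = s * Fintype.card K ^ Module.finrank K V := by
  classical
  have : Finite V := Module.finite_of_finite K
  have := Fintype.ofFinite V
  obtain ⟨v₀, hv₀⟩ := h.functional_surjective hM f
  obtain ⟨p, hp⟩ : ∃ p, f p ≠ 0 := by
    by_contra! hcon
    exact hf (LinearMap.ext hcon)
  have hp0 : functional B M p = 0 := LinearMap.ext fun u => (hM p p.2).2 u u.2
  set T : Finset V := Finset.univ.filter fun v => functional B M v = f with hT
  have hTcard : T.card * Fintype.card K ^ Module.finrank K M =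
      Fintype.card K ^ Module.finrank K V := by
    rw [← h.natCard_ker_functional hM, ← AddMonoidHom.ncard_fibre _ v₀,
      Set.ncard_eq_toFinset_card']
    congr 2
    ext v
    simp only [hT, Finset.mem_filter, Finset.mem_univ, true_and, ← hv₀]
    rw [Set.mem_toFinset]
    rfl
  -- Translation by multiples of `p ∈ M` preserves the functional. The pairs `(v, a)` with `B v = f`
  -- on `M` and `v + a p` isotropic are now counted in two ways.
  have hmap : ∀ a : K, functional B M (a • (p : V)) = 0 := fun a => by
    rw [LinearMap.map_smulₛₗ, hp0, smul_zero]
  have h1 : ∑ v ∈ T, ∑ a : K, (if I (v + a • (p : V)) then 1 else 0) = T.card * s := by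
    rw [← smul_eq_mul, ← Finset.sum_const]
    refine Finset.sum_congr rfl fun v hv => ?_
    rw [Finset.sum_boole, Nat.cast_id, ← h.ncard_line p v (hM p p.2).1 (by
      rw [← functional_apply M v p, (Finset.mem_filter.mp hv).2]; exact hp),
      Set.ncard_eq_toFinset_card', Set.toFinset_ofPred]
  have h2 : ∑ a : K, ∑ v ∈ T, (if I (v + a • (p : V)) then 1 else 0) =
      Fintype.card K * ({v | I v ∧ functional B M v = f} : Set V).ncard := by
    rw [← Finset.card_univ, ← smul_eq_mul, ← Finset.sum_const]
    refine Finset.sum_congr rfl fun a _ => ?_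
    rw [Finset.sum_boole, Nat.cast_id, Set.ncard_eq_toFinset_card']
    refine Finset.card_bij' (fun v _ => v + a • (p : V)) (fun v _ => v - a • (p : V)) ?_ ?_ ?_ ?_
    · intro v hv
      have hv' : functional B M v = f ∧ I (v + a • (p : V)) := by simpa [hT] using hv
      simp [hv'.2, map_add, hmap, hv'.1]
    · intro v hv
      have hv' : I v ∧ functional B M v = f := by simpa using hv
      simp [hT, hv'.1, map_sub, hmap, hv'.2]
    · intro v _
      simp
    · intro v _
      simp
  rw [← h2, Finset.sum_comm, h1, ← hTcard]
  ring

end IsPolarForm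

end PolarForm

/-! ### Neighbours of a maximal totally isotropic subspace -/

section Neighbours

variable {K V : Type*} [Field K] [AddCommGroup V] [Module K V] {σ : K →+* K}

/-- The totally isotropic subspace spanned by `v` and the part of `y` orthogonal to `v`. -/
def nbr (B : V →ₛₗ[σ] V →ₗ[K] K) (y : Submodule K V) (v : V) : Submodule K V :=
  (y ⊓ LinearMap.ker (B v)) ⊔ Submodule.span K {v}

/-- `y` and `z` are maximal totally isotropic subspaces of dimension `D` that meet in a
hyperplane. -/
structure IsNbr (B : V →ₛₗ[σ] V →ₗ[K] K) (I : V → Prop) (D : ℕ) (y z : Submodule K V) :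
    Prop where
  left : Maximal (Iso B I) y
  right : Maximal (Iso B I) z
  finrank_inf : Module.finrank K ↥(y ⊓ z) + 1 = D

variable {B : V →ₛₗ[σ] V →ₗ[K] K} {I : V → Prop} {s D : ℕ}

theorem IsNbr.symm {y z : Submodule K V} (h : IsNbr B I D y z) : IsNbr B I D z y :=
  ⟨h.right, h.left, by rw [inf_comm]; exact h.finrank_inf⟩

theorem mem_nbr (y : Submodule K V) (v : V) : v ∈ nbr B y v :=
  Submodule.mem_sup_right (Submodule.mem_span_singleton_self v)

variable [Fintype K] [Module.Finite K V]

namespace IsPolarForm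

variable (h : IsPolarForm B I s) (hD : ∀ M, Maximal (Iso B I) M → Module.finrank K M = D)
include h hD

theorem maximal_of_finrank {U : Submodule K V} (hU : Iso B I U) (hr : Module.finrank K U = D) :
    Maximal (Iso B I) U := by
  obtain ⟨M, hUM, hM⟩ := h.exists_maximal_ge hU
  rwa [Submodule.eq_of_le_of_finrank_eq hUM (hr.trans (hD M hM).symm)]

theorem finrank_inf_ker {y : Submodule K V} (hy : Maximal (Iso B I) y) {v : V} (hv : I v)
    (hvy : v ∉ y) : Module.finrank K ↥(y ⊓ LinearMap.ker (B v)) + 1 = D := by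
  have hne : functional B y v ≠ 0 := by
    intro h0
    refine hvy (h.mem_of_perp hy hv fun u hu => h.refl _ _ ?_)
    rw [← functional_apply y v ⟨u, hu⟩, h0]
    rfl
  have e := Module.Dual.finrank_ker_add_one_of_ne_zero hne
  rw [hD y hy] at e
  have e' : y ⊓ LinearMap.ker (B v) = (LinearMap.ker (functional B y v)).map y.subtype := by
    ext u
    simp only [Submodule.mem_inf, LinearMap.mem_ker, Submodule.mem_map, Submodule.subtype_apply,
      Subtype.exists, exists_and_right, exists_eq_right, functional_apply, exists_prop]
  rw [e', Submodule.finrank_map_subtype_eq, e]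

theorem isNbr_nbr {y : Submodule K V} (hy : Maximal (Iso B I) y) {v : V} (hv : I v)
    (hvy : v ∉ y) : IsNbr B I D y (nbr B y v) := by
  have h1 := h.finrank_inf_ker hD hy hv hvy
  have hiso : Iso B I (nbr B y v) :=
    h.iso_sup_span (hy.prop.mono inf_le_left) hv fun u hu => h.refl _ _ hu.2
  have h2 : Module.finrank K (nbr B y v) = D := by
    rw [nbr, finrank_sup_span fun hv' : v ∈ y ⊓ LinearMap.ker (B v) => hvy hv'.1, h1]
  have h3 : y ⊓ nbr B y v = y ⊓ LinearMap.ker (B v) :=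
    le_antisymm (fun u hu => ⟨hu.1, (hiso v (mem_nbr y v)).2 u hu.2⟩)
      (le_inf inf_le_left le_sup_left)
  exact ⟨hy, h.maximal_of_finrank hD hiso h2, by rw [h3, h1]⟩

theorem inf_eq_inf_ker {y z : Submodule K V} (hz : IsNbr B I D y z) {v : V} (hv : v ∈ z)
    (hvy : v ∉ y) : y ⊓ z = y ⊓ LinearMap.ker (B v) := by
  have h1 := h.finrank_inf_ker hD hz.left (hz.right.prop v hv).1 hvy
  have hle : y ⊓ z ≤ y ⊓ LinearMap.ker (B v) :=
    fun u hu => ⟨hu.1, (hz.right.prop v hv).2 u hu.2⟩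
  exact Submodule.eq_of_le_of_finrank_eq hle (by have := hz.finrank_inf; omega)

/-- A neighbour of `y` is the span of its intersection with `y`, forced by `inf_eq_inf_ker`, and any
one of its vectors outside `y`. -/
theorem eq_nbr {y z : Submodule K V} (hz : IsNbr B I D y z) {v : V} (hv : v ∈ z)
    (hvy : v ∉ y) : z = nbr B y v := by
  have h2 := h.isNbr_nbr hD hz.left (hz.right.prop v hv).1 hvy
  symm
  refine Submodule.eq_of_le_of_finrank_eq ?_ ((hD _ h2.right).trans (hD _ hz.right).symm)
  rw [nbr, ← h.inf_eq_inf_ker hD hz hv hvy]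
  exact sup_le inf_le_right (by simpa using hv)

/-- If `x` meets `z` outside `y`, then the part of `x` in `y` lies in `z`. -/
theorem inf_le_of_not_le {x y z : Submodule K V} (hx : Iso B I x) (hz : IsNbr B I D y z)
    (hne : ¬ x ⊓ z ≤ y) : x ⊓ y ≤ z := by
  obtain ⟨v, hv, hvy⟩ := SetLike.not_le_iff_exists.mp hne
  rw [h.eq_nbr hD hz hv.2 hvy]
  intro p hp
  exact Submodule.mem_sup_left ⟨hp.2, (hx v hv.1).2 p hp.1⟩

/-- In `z` the subspace `y ⊓ z` is a hyperplane, which cuts `x ⊓ z` in codimension at most one. -/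
theorem finrank_inf_le {x y z : Submodule K V} (hz : IsNbr B I D y z) :
    Module.finrank K ↥(x ⊓ z) ≤ Module.finrank K ↥(x ⊓ y ⊓ z) + 1 := by
  have e := Submodule.finrank_sup_add_finrank_inf_eq (x ⊓ z) (y ⊓ z)
  have e' : x ⊓ z ⊓ (y ⊓ z) = x ⊓ y ⊓ z := by
    rw [inf_inf_inf_comm, inf_idem]
  have hle : x ⊓ z ⊔ y ⊓ z ≤ z := sup_le inf_le_right inf_le_right
  have := Submodule.finrank_mono hle
  rw [hD z hz.right] at this
  have := hz.finrank_inf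
  rw [e'] at e
  omega

theorem finrank_inf_of_not_le {x y z : Submodule K V} (hx : Iso B I x) (hz : IsNbr B I D y z)
    (hne : ¬ x ⊓ z ≤ y) :
    Module.finrank K ↥(x ⊓ z) = Module.finrank K ↥(x ⊓ y) + 1 := by
  have h1 := h.inf_le_of_not_le hD hx hz hne
  have h2 := h.finrank_inf_le hD (x := x) hz
  rw [inf_eq_left.mpr h1] at h2
  have h3 : x ⊓ y < x ⊓ z := lt_of_le_not_ge (le_inf inf_le_left h1)
    fun hle => hne (hle.trans inf_le_right)
  have := Submodule.finrank_lt_finrank_of_lt h3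
  omega

theorem closer_iff {x y z : Submodule K V} (hx : Iso B I x) (hz : IsNbr B I D y z) :
    Module.finrank K ↥(x ⊓ z) = Module.finrank K ↥(x ⊓ y) + 1 ↔ ¬ x ⊓ z ≤ y := by
  refine ⟨fun he hle => ?_, h.finrank_inf_of_not_le hD hx hz⟩
  have := Submodule.finrank_mono (le_inf inf_le_left hle : x ⊓ z ≤ x ⊓ y)
  omega

theorem farther_iff {x y z : Submodule K V} (hx : Iso B I x) (hz : IsNbr B I D y z) :
    Module.finrank K ↥(x ⊓ z) + 1 = Module.finrank K ↥(x ⊓ y) ↔ ¬ x ⊓ y ≤ z := by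
  rw [← h.closer_iff hD hx hz.symm, eq_comm]

theorem finrank_inf_cases {x y z : Submodule K V} (hx : Iso B I x) (hz : IsNbr B I D y z) :
    Module.finrank K ↥(x ⊓ z) = Module.finrank K ↥(x ⊓ y) + 1 ∨
    Module.finrank K ↥(x ⊓ z) + 1 = Module.finrank K ↥(x ⊓ y) ∨
    Module.finrank K ↥(x ⊓ z) = Module.finrank K ↥(x ⊓ y) := by
  rw [h.closer_iff hD hx hz, h.farther_iff hD hx hz]
  by_cases h1 : x ⊓ z ≤ y
  · by_cases h2 : x ⊓ y ≤ z
    · right; right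
      rw [le_antisymm (le_inf inf_le_left h1) (le_inf inf_le_left h2)]
    · exact Or.inr (Or.inl h2)
  · exact Or.inl h1

/-- The number of neighbours of `y` that are closer to `x`. -/
theorem ncard_closer {x y : Submodule K V} (hx : Maximal (Iso B I) x)
    (hy : Maximal (Iso B I) y) :
    ({z | IsNbr B I D y z ∧ ¬ x ⊓ z ≤ y} : Set (Submodule K V)).ncard *
      (Fintype.card K - 1) + 1 = Fintype.card K ^ (D - Module.finrank K ↥(x ⊓ y)) := by
  have : Finite V := Module.finite_of_finite K
  set q := Fintype.card K
  have hq : 1 < q := Fintype.one_lt_card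
  set d := Module.finrank K ↥(x ⊓ y) with hd
  have hdD : d ≤ D := by
    rw [← hD x hx]
    exact Submodule.finrank_mono inf_le_left
  have e1 := ncard_submodule_diff x y
  rw [hD x hx, ← hd] at e1
  -- Each vector of `x` outside `y` spans with its orthogonal part of `y` one closer neighbour `z`,
  -- and `z` arises from the `q^{d+1} - q^d` vectors of `x ⊓ z` outside `y`.
  have e2 := ncard_eq_mul_of_fibres (A := (x : Set V) \ y)
    (T := {z | IsNbr B I D y z ∧ ¬ x ⊓ z ≤ y}) (nbr B y) (m := q ^ (d + 1) - q ^ d)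
    (fun v hv => ⟨h.isNbr_nbr hD hy (hx.prop v hv.1).1 hv.2,
      fun hle => hv.2 (hle ⟨hv.1, mem_nbr y v⟩)⟩) (by
      rintro z ⟨hz, hne⟩
      have e3 := ncard_submodule_diff (x ⊓ z) y
      rw [inf_right_comm, inf_eq_left.mpr (h.inf_le_of_not_le hD hx.prop hz hne),
        h.finrank_inf_of_not_le hD hx.prop hz hne, ← hd] at e3
      rw [← e3, Nat.add_sub_cancel]
      congr 1
      ext v
      constructor
      · rintro ⟨⟨h1, h2⟩, rfl⟩
        exact ⟨⟨h1, mem_nbr y v⟩, h2⟩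
      · rintro ⟨⟨h1, h2⟩, h3⟩
        exact ⟨⟨h1, h3⟩, (h.eq_nbr hD hz h2 h3).symm⟩)
  rw [e2] at e1
  apply Nat.eq_of_mul_eq_mul_right (pow_pos (by omega : 0 < q) d)
  rw [← pow_add, Nat.sub_add_cancel hdD, ← e1, pow_succ, ← Nat.mul_sub_one]
  ring

/-- The number of neighbours of `y` that contain a given subspace `P` of `y`. -/
theorem ncard_isNbr_ge {y P : Submodule K V} (hy : Maximal (Iso B I) y) (hP : P ≤ y)
    (hn : 2 * D ≤ Module.finrank K V) :
    ({z | IsNbr B I D y z ∧ P ≤ z} : Set (Submodule K V)).ncard * (Fintype.card K - 1) =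
      (s * Fintype.card K ^ (Module.finrank K V - 2 * D)) *
        (Fintype.card K ^ (D - Module.finrank K P) - 1) := by
  classical
  have : Finite V := Module.finite_of_finite K
  have : Finite (Module.Dual K y) := Module.finite_of_finite K
  set q := Fintype.card K with hqdef
  have hq : 1 < q := Fintype.one_lt_card
  set T : Set (Submodule K V) := {z | IsNbr B I D y z ∧ P ≤ z} with hT
  set A : Set V := {v | I v ∧ v ∉ y ∧ ∀ p ∈ P, B v p = 0} with hA
  by_cases hD0 : D = 0
  · have hT0 : T = ∅ := by
      ext z
      simp only [hT, Set.mem_ofPred_eq, Set.mem_empty_iff_false, iff_false]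
      rintro ⟨hz, -⟩
      have := hz.finrank_inf
      omega
    rw [hT0, hD0]
    simp
  -- The set `A` is counted in two ways. Here it is sorted by the neighbour that a vector generates;
  -- each neighbour has `q^D - q^{D-1}` vectors outside `y`.
  have e2 : A.ncard = T.ncard * (q ^ D - q ^ (D - 1)) :=
    ncard_eq_mul_of_fibres (nbr B y)
      (fun v hv => ⟨h.isNbr_nbr hD hy hv.1 hv.2.1,
        fun p hp => Submodule.mem_sup_left ⟨hP hp, hv.2.2 p hp⟩⟩) (by
      rintro z ⟨hz, hPz⟩
      have e3 := ncard_submodule_diff z y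
      have e4 : Module.finrank K ↥(z ⊓ y) = D - 1 := by
        have := hz.symm.finrank_inf
        omega
      rw [hD z hz.right, e4] at e3
      rw [← e3, Nat.add_sub_cancel]
      congr 1
      ext v
      constructor
      · rintro ⟨⟨h1, h2, h3⟩, rfl⟩
        exact ⟨mem_nbr y v, h2⟩
      · rintro ⟨h1, h2⟩
        exact ⟨⟨(hz.right.prop v h1).1, h2, fun p hp => (hz.right.prop v h1).2 p (hPz hp)⟩,
          (h.eq_nbr hD hz h1 h2).symm⟩)
  let P' : Submodule K y := P.comap y.subtype
  have hP' : Module.finrank K P' = Module.finrank K P :=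
    (Submodule.comapSubtypeEquivOfLe hP).finrank_eq
  have hann := Subspace.finrank_add_finrank_dualAnnihilator_eq P'
  rw [hP', hD y hy] at hann
  have hann' : Module.finrank K P'.dualAnnihilator = D - Module.finrank K P := by omega
  have hyn : Module.finrank K V = D + (Module.finrank K V - D) := by omega
  obtain ⟨m, hm⟩ : ∃ m, q * m * q ^ D = s * q ^ Module.finrank K V ∧
      ∀ f : Module.Dual K y, f ≠ 0 → ({v | I v ∧ functional B y v = f} : Set V).ncard = m := by
    by_cases hex : ∃ f : Module.Dual K y, f ≠ 0
    · obtain ⟨f, hf⟩ := hex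
      have key : ∀ f : Module.Dual K y, f ≠ 0 → _ := fun f hf =>
        h.ncard_isotropic_functional hy.prop hf
      rw [hD y hy, ← hqdef] at key
      refine ⟨_, key f hf, fun f' hf' => ?_⟩
      have := (key f' hf').trans (key f hf).symm
      have := Nat.eq_of_mul_eq_mul_right (pow_pos (by omega : 0 < q) D) this
      exact Nat.eq_of_mul_eq_mul_left (by omega) this
    · exfalso
      push Not at hex
      have : Subsingleton (Module.Dual K y) := ⟨fun a b => by rw [hex a, hex b]⟩
      have h0 : Module.finrank K (Module.Dual K y) = 0 := Module.finrank_zero_of_subsingleton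
      rw [Subspace.dual_finrank_eq, hD y hy] at h0
      exact hD0 h0
  -- The second count sorts the vectors by the functional they induce on `y`: it is nonzero, as the
  -- vector lies outside `y`, and it vanishes on `P`.
  have e5 : A.ncard = ((P'.dualAnnihilator : Set (Module.Dual K y)) \ {0}).ncard * m :=
    ncard_eq_mul_of_fibres (functional B y)
      (fun v hv => by
        refine ⟨?_, ?_⟩
        · rw [SetLike.mem_coe, Submodule.mem_dualAnnihilator]
          exact fun u hu => hv.2.2 u hu
        · intro h0
          have h0' : functional B y v = 0 := h0
          refine hv.2.1 (h.mem_of_perp hy hv.1 fun u hu => h.refl _ _ ?_)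
          rw [← functional_apply y v ⟨u, hu⟩, h0']
          rfl) (by
      rintro f ⟨hf, hf0⟩
      rw [← hm.2 f hf0]
      congr 1
      ext v
      constructor
      · rintro ⟨⟨h1, -, -⟩, h2⟩
        exact ⟨h1, h2⟩
      · rintro ⟨h1, rfl⟩
        refine ⟨⟨h1, fun hvy => hf0 (LinearMap.ext fun u => (hy.prop v hvy).2 u u.2), ?_⟩, rfl⟩
        intro p hp
        exact (Submodule.mem_dualAnnihilator _).mp hf ⟨p, hP hp⟩ hp)
  have e6 : ((P'.dualAnnihilator : Set (Module.Dual K y)) \ {0}).ncard =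
      q ^ (D - Module.finrank K P) - 1 := by
    rw [Set.ncard_sdiff_singleton_of_mem (by simp), ncard_submodule, hann']
  rw [e6] at e5
  have e7 : q ^ D - q ^ (D - 1) = q ^ (D - 1) * (q - 1) := by
    obtain ⟨k, rfl⟩ := Nat.exists_eq_succ_of_ne_zero hD0
    simp [pow_succ, Nat.mul_sub_one]
  rw [e2, e7] at e5
  have e8 : q ^ Module.finrank K V = q ^ (Module.finrank K V - 2 * D) * q ^ D * q ^ D := by
    rw [← pow_add, ← pow_add]
    congr 1
    omega
  have e9 : q ^ D = q ^ (D - 1) * q := by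
    rw [← pow_succ]
    congr 1
    omega
  apply Nat.eq_of_mul_eq_mul_right (pow_pos (by omega : 0 < q) D)
  have e10 : q * m = s * q ^ (Module.finrank K V - 2 * D) * q ^ D := by
    apply Nat.eq_of_mul_eq_mul_right (pow_pos (by omega : 0 < q) D)
    rw [hm.1, e8]
    ring
  calc T.ncard * (q - 1) * q ^ D = T.ncard * (q ^ (D - 1) * (q - 1)) * q := by rw [e9]; ring
    _ = (q ^ (D - Module.finrank K P) - 1) * (q * m) := by rw [e5]; ring
    _ = _ := by rw [e10]; ring

/-- There is a maximal totally isotropic subspace through `U` that meets `y` outside `U`. -/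
theorem exists_gate {U y : Submodule K V} (hU : Iso B I U) (hr : Module.finrank K U + 1 = D)
    (hy : Maximal (Iso B I) y) : ∃ c, Maximal (Iso B I) c ∧ U ≤ c ∧ ¬ y ⊓ c ≤ U := by
  -- As `dim U = D - 1`, this makes `y ⊓ perp B U` strictly larger than `y ⊓ U`; a vector in the
  -- difference extends `U` to the gate.
  have h1 := h.finrank_add_le (P := y ⊓ U) (U := U) (W := y) inf_le_right
    fun w hw p hp => (hy.prop w hw).2 p hp.1
  rw [hD y hy] at h1
  obtain ⟨v, hv, hvU⟩ : ∃ v ∈ y ⊓ perp B U, v ∉ U := by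
    by_contra! hcon
    have := Submodule.finrank_mono (le_inf inf_le_left hcon : y ⊓ perp B U ≤ y ⊓ U)
    omega
  refine ⟨U ⊔ Submodule.span K {v}, h.maximal_of_finrank hD
    (h.iso_sup_span hU (hy.prop v hv.1).1 hv.2) (by rw [finrank_sup_span hvU, hr]), le_sup_left,
    fun hle => hvU (hle ⟨hv.1, Submodule.mem_sup_right (Submodule.mem_span_singleton_self v)⟩)⟩

theorem eq_sup_span {U c : Submodule K V} (hr : Module.finrank K U + 1 = D)
    (hc : Maximal (Iso B I) c) (hUc : U ≤ c) {v : V} (hv : v ∈ c) (hvU : v ∉ U) :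
    c = U ⊔ Submodule.span K {v} := by
  symm
  refine Submodule.eq_of_le_of_finrank_eq (sup_le hUc (by simpa using hv)) ?_
  rw [finrank_sup_span hvU, hr, hD c hc]

/-- A vector `v` of `y ⊓ c` outside `U` is orthogonal to `U` and to any such vector `v'` of `y ⊓
c'`, hence to `c' = U + ⟨v'⟩`. By maximality `v ∈ c'`, so both subspaces equal `U + ⟨v⟩`. -/
theorem gate_unique {U y c c' : Submodule K V} (hr : Module.finrank K U + 1 = D)
    (hy : Iso B I y) (hc : Maximal (Iso B I) c) (hUc : U ≤ c) (hyc : ¬ y ⊓ c ≤ U)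
    (hc' : Maximal (Iso B I) c') (hUc' : U ≤ c') (hyc' : ¬ y ⊓ c' ≤ U) : c' = c := by
  obtain ⟨v, hv, hvU⟩ := SetLike.not_le_iff_exists.mp hyc
  obtain ⟨v', hv', hvU'⟩ := SetLike.not_le_iff_exists.mp hyc'
  have e := h.eq_sup_span hD hr hc hUc hv.2 hvU
  have e' := h.eq_sup_span hD hr hc' hUc' hv'.2 hvU'
  have hvc' : v ∈ c' := by
    refine h.mem_of_perp hc' (hy v hv.1).1 ?_
    intro w hw
    rw [e'] at hw
    obtain ⟨u, hu, a, rfl⟩ := mem_sup_span_singleton.mp hw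
    simp [(hc.prop u (hUc hu)).2 v hv.2, (hy v' hv'.1).2 v hv.1]
  rw [e, h.eq_sup_span hD hr hc' hUc' hvc' hvU]

theorem finrank_inf_gate {U y c : Submodule K V} (hr : Module.finrank K U + 1 = D)
    (hc : Maximal (Iso B I) c) (hUc : U ≤ c) (hyc : ¬ y ⊓ c ≤ U) :
    Module.finrank K ↥(y ⊓ c) = Module.finrank K ↥(y ⊓ U) + 1 := by
  have e := Submodule.finrank_sup_add_finrank_inf_eq (y ⊓ c) U
  have e' : y ⊓ c ⊓ U = y ⊓ U := by rw [inf_assoc, inf_eq_right.mpr hUc]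
  have hle := Submodule.finrank_mono (sup_le inf_le_right hUc : y ⊓ c ⊔ U ≤ c)
  have hlt : y ⊓ U < y ⊓ c := lt_of_le_not_ge (inf_le_inf_left _ hUc)
    fun hle => hyc (hle.trans inf_le_right)
  have := Submodule.finrank_lt_finrank_of_lt hlt
  rw [e'] at e
  rw [hD c hc] at hle
  omega

end IsPolarForm

end Neighbours

/-! ### The dual polar graph of a polar form -/

/-- The step condition bounds the distance below by `δ`; descending along `δ` yields a walk of that
length. -/
theorem dist_eq_of_descent {X : Type*} {Γ : SimpleGraph X} {δ : X → ℕ} {x : X}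
    (h0 : ∀ y, δ y = 0 ↔ y = x) (hstep : ∀ y z, Γ.Adj y z → δ y ≤ δ z + 1)
    (hdesc : ∀ y, δ y ≠ 0 → ∃ z, Γ.Adj y z ∧ δ z + 1 = δ y) (y : X) :
    Γ.Reachable x y ∧ Γ.dist x y = δ y := by
  have h1 : ∀ n y, δ y = n → ∃ p : Γ.Walk y x, p.length = n := by
    intro n
    induction n with
    | zero =>
      intro y hy
      obtain rfl := (h0 y).mp hy
      exact ⟨.nil, rfl⟩
    | succ n ih =>
      intro y hy
      obtain ⟨z, hz, hd⟩ := hdesc y (by omega)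
      obtain ⟨p, hp⟩ := ih z (by omega)
      exact ⟨.cons hz p, by simp [hp]⟩
  have h2 : ∀ u v (p : Γ.Walk u v), δ u ≤ δ v + p.length := by
    intro u v p
    induction p with
    | nil => simp
    | cons hadj p ih =>
      have := hstep _ _ hadj
      rw [SimpleGraph.Walk.length_cons]
      omega
  obtain ⟨p, hp⟩ := h1 _ y rfl
  refine ⟨p.reachable.symm, ?_⟩
  rw [SimpleGraph.dist_comm]
  apply le_antisymm
  · rw [← hp]
    exact SimpleGraph.dist_le p
  · obtain ⟨r, hr⟩ := p.reachable.exists_walk_length_eq_dist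
    have := h2 y x r
    rw [(h0 x).mpr rfl, hr] at this
    omega

section Graph

variable {K V : Type*} [Field K] [Fintype K] [AddCommGroup V] [Module K V] [Module.Finite K V]
  {D : ℕ} {σ : K →+* K}

/-- The polar space `S` of rank `D` is described by the polar form `B`, `I`. -/
structure PolarSpace.IsModel (S : PolarSpace K V D) (B : V →ₛₗ[σ] V →ₗ[K] K) (I : V → Prop)
    (s : ℕ) : Prop where
  form : IsPolarForm B I s
  iso_iff : ∀ U, S.IsIsotropic U ↔ Iso B I U
  finrank_eq : ∀ M, Maximal (Iso B I) M → Module.finrank K M = D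
  le_finrank : 2 * D ≤ Module.finrank K V
  one_le : 1 ≤ s
  pos : 1 ≤ D

namespace PolarSpace.IsModel

variable {S : PolarSpace K V D} {B : V →ₛₗ[σ] V →ₗ[K] K} {I : V → Prop} {s : ℕ}
  (m : S.IsModel B I s)
include m

theorem maximal (y : S.Vertex) : Maximal (Iso B I) y.1 := by
  have : S.IsIsotropic = Iso B I := funext fun U => propext (m.iso_iff U)
  rw [← this]
  exact y.2

theorem maximal_isIsotropic {M : Submodule K V} (hM : Maximal (Iso B I) M) :
    Maximal S.IsIsotropic M := by
  have : S.IsIsotropic = Iso B I := funext fun U => propext (m.iso_iff U)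
  rw [this]
  exact hM

theorem finrank_vertex (y : S.Vertex) : Module.finrank K y.1 = D :=
  m.finrank_eq _ (m.maximal y)

theorem adj_iff {y z : S.Vertex} : S.graph.Adj y z ↔ IsNbr B I D y.1 z.1 := by
  constructor
  · exact fun hyz => ⟨m.maximal y, m.maximal z, hyz.2⟩
  · refine fun hyz => ⟨?_, hyz.finrank_inf⟩
    rintro rfl
    have := hyz.finrank_inf
    rw [inf_idem, m.finrank_vertex] at this
    omega

theorem finrank_inf_le (x y : S.Vertex) : Module.finrank K ↥(x.1 ⊓ y.1) ≤ D :=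
  (Submodule.finrank_mono inf_le_left).trans (m.finrank_vertex x).le

theorem finrank_inf_eq_iff {x y : S.Vertex} : Module.finrank K ↥(x.1 ⊓ y.1) = D ↔ y = x := by
  constructor
  · intro h
    have h1 := Submodule.eq_of_le_of_finrank_eq (inf_le_left : x.1 ⊓ y.1 ≤ x.1)
      (h.trans (m.finrank_vertex x).symm)
    have h2 := Submodule.eq_of_le_of_finrank_eq (inf_le_right : x.1 ⊓ y.1 ≤ y.1)
      (h.trans (m.finrank_vertex y).symm)
    exact Subtype.ext (h2.symm.trans h1)
  · rintro rfl
    rw [inf_idem, m.finrank_vertex]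

theorem ncard_vertex (y : S.Vertex) (P : Submodule K V → Prop) :
    ({z | S.graph.Adj y z ∧ P z.1} : Set S.Vertex).ncard =
      ({z | IsNbr B I D y.1 z ∧ P z} : Set (Submodule K V)).ncard := by
  have hinj : Function.Injective fun z : S.Vertex => z.1 := Subtype.val_injective
  refine (Set.ncard_image_of_injective _ hinj).symm.trans ?_
  congr 1
  ext z
  constructor
  · rintro ⟨z, ⟨h1, h2⟩, rfl⟩
    exact ⟨m.adj_iff.mp h1, h2⟩
  · rintro ⟨h1, h2⟩
    exact ⟨⟨z, m.maximal_isIsotropic h1.right⟩, ⟨m.adj_iff.mpr h1, h2⟩, rfl⟩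

theorem ncard_closer (x y : S.Vertex) :
    ({z | S.graph.Adj y z ∧ ¬ x.1 ⊓ z.1 ≤ y.1} : Set S.Vertex).ncard * (Fintype.card K - 1) + 1 =
      Fintype.card K ^ (D - Module.finrank K ↥(x.1 ⊓ y.1)) := by
  rw [m.ncard_vertex y fun z => ¬ x.1 ⊓ z ≤ y.1]
  exact m.form.ncard_closer m.finrank_eq (m.maximal x) (m.maximal y)

theorem ncard_adj_ge (y : S.Vertex) {P : Submodule K V} (hP : P ≤ y.1) :
    ({z | S.graph.Adj y z ∧ P ≤ z.1} : Set S.Vertex).ncard * (Fintype.card K - 1) =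
      (s * Fintype.card K ^ (Module.finrank K V - 2 * D)) *
        (Fintype.card K ^ (D - Module.finrank K P) - 1) := by
  rw [m.ncard_vertex y fun z => P ≤ z]
  exact m.form.ncard_isNbr_ge m.finrank_eq (m.maximal y) hP m.le_finrank

/-- Dimensions of intersections with `x` change by at most one along an edge, and the count of
closer neighbours is positive unless `y = x`. -/
theorem reachable_and_dist (x y : S.Vertex) :
    S.graph.Reachable x y ∧ S.graph.dist x y = D - Module.finrank K ↥(x.1 ⊓ y.1) := by
  have hle := m.finrank_inf_le x
  refine dist_eq_of_descent (δ := fun y : S.Vertex => D - Module.finrank K ↥(x.1 ⊓ y.1))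
    (fun y => ?_) (fun y z hyz => ?_) (fun y hy => ?_) y
  · rw [← m.finrank_inf_eq_iff]
    have := hle y
    omega
  · have := hle y
    rcases m.form.finrank_inf_cases m.finrank_eq (m.maximal x).prop (m.adj_iff.mp hyz) with
      h1 | h1 | h1 <;> omega
  · have h1 := m.ncard_closer x y
    have h2 : ({z | S.graph.Adj y z ∧ ¬ x.1 ⊓ z.1 ≤ y.1} : Set S.Vertex).ncard ≠ 0 := by
      intro h0
      rw [h0, zero_mul, zero_add] at h1
      have := Nat.one_lt_pow hy (Fintype.one_lt_card (α := K))
      omega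
    obtain ⟨z, hz, hne⟩ := Set.nonempty_of_ncard_ne_zero h2
    refine ⟨z, hz, ?_⟩
    have h3 := (m.form.closer_iff m.finrank_eq (m.maximal x).prop (m.adj_iff.mp hz)).mpr hne
    have := hle z
    omega

theorem dist_add (x y : S.Vertex) :
    S.graph.dist x y + Module.finrank K ↥(x.1 ⊓ y.1) = D := by
  have := m.finrank_inf_le x y
  rw [(m.reachable_and_dist x y).2]
  omega

theorem cast_pow_sub_one (k : ℕ) :
    ((Fintype.card K ^ k - 1 : ℕ) : ℂ) = (Fintype.card K : ℂ) ^ k - 1 := by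
  rw [Nat.cast_sub (Nat.one_le_pow _ _ Fintype.card_pos)]
  push_cast
  rfl

theorem cast_card_sub_one : ((Fintype.card K - 1 : ℕ) : ℂ) = (Fintype.card K : ℂ) - 1 := by
  simpa using m.cast_pow_sub_one 1

theorem isDualPolarLike [Nonempty S.Vertex] :
    IsDualPolarLike S.graph D (Fintype.card K)
      (s * Fintype.card K ^ (Module.finrank K V - 2 * D)) where
  two_le := Fintype.one_lt_card
  one_le := Nat.mul_pos m.one_le (pow_pos Fintype.card_pos _)
  connected := { preconnected := fun x y => (m.reachable_and_dist x y).1 }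
  dist_le x y := by
    have := m.dist_add x y
    omega
  closer x y := by
    have e : ({z | S.graph.Adj y z ∧ S.graph.dist x z + 1 = S.graph.dist x y} : Set S.Vertex) =
        {z | S.graph.Adj y z ∧ ¬ x.1 ⊓ z.1 ≤ y.1} := by
      ext z
      refine and_congr_right fun hz => ?_
      rw [← m.form.closer_iff m.finrank_eq (m.maximal x).prop (m.adj_iff.mp hz)]
      have := m.dist_add x y
      have := m.dist_add x z
      omega
    have h1 := m.ncard_closer x y
    rw [← (m.reachable_and_dist x y).2] at h1
    rw [e, ← m.cast_card_sub_one, ← m.cast_pow_sub_one, ← h1, Nat.add_sub_cancel]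
    push_cast
    ring
  farther x y := by
    -- The farther neighbours are those that do not contain `x ⊓ y`, so their number is a difference
    -- of two values of `ncard_adj_ge`.
    have e : ({z | S.graph.Adj y z ∧ S.graph.dist x z = S.graph.dist x y + 1} : Set S.Vertex) =
        {z | S.graph.Adj y z ∧ (⊥ : Submodule K V) ≤ z.1} \
          {z | S.graph.Adj y z ∧ x.1 ⊓ y.1 ≤ z.1} := by
      ext z
      have : S.graph.Adj y z → (S.graph.dist x z = S.graph.dist x y + 1 ↔
          ¬ x.1 ⊓ y.1 ≤ z.1) := by
        intro hz
        rw [← m.form.farther_iff m.finrank_eq (m.maximal x).prop (m.adj_iff.mp hz)]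
        have := m.dist_add x y
        have := m.dist_add x z
        omega
      simp only [Set.mem_ofPred_eq, Set.mem_sdiff, bot_le, and_true]
      tauto
    have h1 := m.ncard_adj_ge y (P := ⊥) bot_le
    have h2 := m.ncard_adj_ge y (P := x.1 ⊓ y.1) inf_le_right
    have h3 := Set.ncard_sdiff_add_ncard_of_subset
      (s := {z | S.graph.Adj y z ∧ x.1 ⊓ y.1 ≤ z.1})
      (t := {z : S.Vertex | S.graph.Adj y z ∧ (⊥ : Submodule K V) ≤ z.1})
      (fun z hz => ⟨hz.1, bot_le⟩) (Set.toFinite _)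
    rw [finrank_bot, Nat.sub_zero] at h1
    rw [← (m.reachable_and_dist x y).2] at h2
    rw [← e] at h3
    have h1' := congrArg (Nat.cast (R := ℂ)) h1
    have h2' := congrArg (Nat.cast (R := ℂ)) h2
    have h3' := congrArg (Nat.cast (R := ℂ)) h3
    simp only [Nat.cast_mul, m.cast_card_sub_one, m.cast_pow_sub_one, Nat.cast_pow,
      Nat.cast_add] at h1' h2' h3' ⊢
    linear_combination h1' - h2' + ((Fintype.card K : ℂ) - 1) * h3'

/-- The maximal cliques are the sets of all vertices through a totally isotropic subspace of
dimension `D - 1`. -/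
theorem exists_eq_of_maximal_isClique {x : S.Vertex} {C : Set S.Vertex}
    (hC : Maximal S.graph.IsClique C) (hx : x ∈ C) :
    ∃ U : Submodule K V, U ≤ x.1 ∧ Module.finrank K U + 1 = D ∧ C = {z | U ≤ z.1} := by
  -- The vertex `x` has a neighbour, so `{x}` is not a maximal clique.
  obtain ⟨y, hy, hxy⟩ : ∃ y ∈ C, y ≠ x := by
    by_contra! hcon
    have h1 := m.ncard_adj_ge x (P := ⊥) bot_le
    have h2 : ({z | S.graph.Adj x z ∧ (⊥ : Submodule K V) ≤ z.1} : Set S.Vertex).ncard ≠ 0 := by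
      intro h0
      rw [h0, zero_mul, finrank_bot, Nat.sub_zero, eq_comm] at h1
      have h3 := Nat.one_lt_pow (Nat.one_le_iff_ne_zero.mp m.pos) (Fintype.one_lt_card (α := K))
      have h4 := Nat.mul_pos m.one_le
        (pow_pos (Fintype.card_pos (α := K)) (Module.finrank K V - 2 * D))
      rcases Nat.mul_eq_zero.mp h1 with h | h <;> omega
    obtain ⟨w, hw, -⟩ := Set.nonempty_of_ncard_ne_zero h2
    have hcl : S.graph.IsClique (insert w C) := by
      intro a ha b hb hab
      rcases ha with rfl | ha <;> rcases hb with rfl | hb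
      · exact absurd rfl hab
      · rw [hcon b hb]; exact hw.symm
      · rw [hcon a ha]; exact hw
      · exact hC.prop ha hb hab
    have hwC := hC.le_of_ge hcl (Set.subset_insert w C) (Set.mem_insert w C)
    exact hw.ne (hcon w hwC).symm
  have hadj := m.adj_iff.mp (hC.prop hx hy hxy.symm)
  refine ⟨x.1 ⊓ y.1, inf_le_left, hadj.finrank_inf, ?_⟩
  refine hC.eq_of_le (y := {z : S.Vertex | x.1 ⊓ y.1 ≤ z.1}) ?_ ?_
  · intro a ha b hb hab
    refine ⟨hab, ?_⟩
    have h1 := Submodule.finrank_mono (le_inf ha hb : x.1 ⊓ y.1 ≤ a.1 ⊓ b.1)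
    have h2 := m.finrank_inf_le a b
    have h3 : Module.finrank K ↥(a.1 ⊓ b.1) ≠ D := fun h => hab (m.finrank_inf_eq_iff.mp h).symm
    have := hadj.finrank_inf
    omega
  · intro z hz
    by_cases hzx : z = x
    · rw [hzx]; exact (inf_le_left : x.1 ⊓ y.1 ≤ x.1)
    by_cases hzy : z = y
    · rw [hzy]; exact (inf_le_right : x.1 ⊓ y.1 ≤ y.1)
    have hxz := m.adj_iff.mp (hC.prop hx hz (Ne.symm hzx))
    have hyz := m.adj_iff.mp (hC.prop hy hz (Ne.symm hzy))
    -- Otherwise `z` would meet `x` in dimension `D - 2`, although they are adjacent.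
    by_contra hne
    have := (m.form.farther_iff m.finrank_eq (m.maximal x).prop hyz).mpr hne
    have := hxz.finrank_inf
    have := hadj.finrank_inf
    omega

theorem exists_isGate {x : S.Vertex} {C : Set S.Vertex}
    (hC : Maximal S.graph.IsClique C) (hx : x ∈ C) :
    ∃ g, IsGate S.graph C g (s * Fintype.card K ^ (Module.finrank K V - 2 * D)) := by
  obtain ⟨U, hUx, hr, rfl⟩ := m.exists_eq_of_maximal_isClique hC hx
  have hiso : Iso B I U := (m.maximal x).prop.mono hUx
  have hex : ∀ y : S.Vertex, ∃ c : S.Vertex, U ≤ c.1 ∧ ¬ y.1 ⊓ c.1 ≤ U := by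
    intro y
    obtain ⟨c, hc, h1, h2⟩ := m.form.exists_gate m.finrank_eq hiso hr (m.maximal y)
    exact ⟨⟨c, m.maximal_isIsotropic hc⟩, h1, h2⟩
  choose g hgU hg using hex
  refine ⟨g, ?_, hgU, ?_⟩
  -- The clique consists of `x` and its neighbours through `U`; as `U` has codimension one in `x`,
  -- there are exactly `N` of these.
  · have e : ({z | U ≤ z.1} : Set S.Vertex) =
        insert x {z | S.graph.Adj x z ∧ U ≤ z.1} := by
      ext z
      constructor
      · intro hz
        by_cases hzx : z = x
        · exact Or.inl hzx
        · exact Or.inr ⟨hC.prop hx hz (Ne.symm hzx), hz⟩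
      · rintro (rfl | hz)
        · exact hUx
        · exact hz.2
    have h1 := m.ncard_adj_ge x hUx
    have h2 : D - Module.finrank K U = 1 := by omega
    rw [h2, pow_one] at h1
    have hq := Fintype.one_lt_card (α := K)
    rw [e, Set.ncard_insert_of_notMem (fun h => h.1.ne rfl),
      Nat.eq_of_mul_eq_mul_right (by omega) h1]
  · intro y c hc hne
    -- By uniqueness of the gate, any other member of the clique meets `y` only inside `U`, one
    -- dimension less than the gate does.
    have h1 : y.1 ⊓ c.1 ≤ U := by
      by_contra hyc
      exact hne (Subtype.ext (m.form.gate_unique m.finrank_eq hr (m.maximal y).prop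
        (m.maximal (g y)) (hgU y) (hg y) (m.maximal c) hc hyc))
    have h2 : y.1 ⊓ c.1 = y.1 ⊓ U :=
      le_antisymm (le_inf inf_le_left h1) (inf_le_inf_left _ hc)
    have h3 := m.form.finrank_inf_gate m.finrank_eq hr (m.maximal (g y)) (hgU y) (hg y)
    have h4 := m.dist_add y c
    have h5 := m.dist_add y (g y)
    rw [h2] at h4
    omega

end PolarSpace.IsModel

/-- The conclusion of the main theorem, for a polar space described by a polar form. -/
theorem nilDAHA_action_of_isModel {S : PolarSpace K V D} {B : V →ₛₗ[σ] V →ₗ[K] K} {I : V → Prop}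
    {s : ℕ} (m : S.IsModel B I s)
    (he : rp (Fintype.card K) S.e =
      (s * Fintype.card K ^ (Module.finrank K V - 2 * D) : ℕ))
    (x : S.Vertex) (C : Set S.Vertex) (hC : Maximal S.graph.IsClique C) (hx : x ∈ C) :
    LinearIndependent ℂ (cellVec S.graph x C D) ∧
    boseMesnerSpan S.graph (charVec {x}) ≤ primaryW S.graph x C D ∧
    boseMesnerSpan S.graph (charVec C) ≤ primaryW S.graph x C D ∧
    ∃ ρ : NilDAHA (kappa (Fintype.card K) S.e) (kappa' (Fintype.card K) D) →ₐ[ℂ]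
        Module.End ℂ (primaryW S.graph x C D),
      IsNilAction (cellVec S.graph x C D) ρ ∧
      (∀ ρ', IsNilAction (cellVec S.graph x C D) ρ' → ρ' = ρ) ∧
      orthProjOn (primaryW S.graph x C D) (boseMesnerSpan S.graph (charVec {x})) =
        (kappa' (Fintype.card K) D + (kappa' (Fintype.card K) D)⁻¹)⁻¹ •
          (ρ (NilDAHA.T' _ _) + (kappa' (Fintype.card K) D)⁻¹ • LinearMap.id) ∧
      orthProjOn (primaryW S.graph x C D) (boseMesnerSpan S.graph (charVec C)) =
        (kappa (Fintype.card K) S.e + (kappa (Fintype.card K) S.e)⁻¹)⁻¹ •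
          (ρ (NilDAHA.T _ _) + (kappa (Fintype.card K) S.e)⁻¹ • LinearMap.id) := by
  have : Nonempty S.Vertex := ⟨x⟩
  have h := m.isDualPolarLike
  obtain ⟨g, hg⟩ := m.exists_isGate hC hx
  obtain ⟨ρ, hρ, huniq⟩ := exists_isNilAction (D := D) (Fintype.card_pos (α := K)) S.e
    (cellBasis h hg hx)
  rw [coe_cellBasis] at hρ huniq
  refine ⟨linearIndependent_cellVec h hg hx, ?_, ?_, ρ, hρ, huniq, ?_, ?_⟩
  · rw [boseMesnerSpan_singleton h hg hx]
    exact span_fibre_sum_le x fun r => (r.1 : ℕ) + (r.2 : ℕ)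
  · rw [boseMesnerSpan_clique h hg hx]
    exact span_fibre_sum_le x fun r => (r.1 : ℕ)
  · exact orthProjOn_singleton h hg hx hρ.repr_T'
  · exact orthProjOn_clique h hg hx he hρ.repr_T

end Graph

/-! ### The rank of a polar form -/

section Rank

variable {K V : Type*} [Field K] [Fintype K] [AddCommGroup V] [Module K V] [Module.Finite K V]
  {σ : K →+* K} {B : V →ₛₗ[σ] V →ₗ[K] K} {I : V → Prop} {s : ℕ}

theorem IsPolarForm.two_mul_finrank_le (h : IsPolarForm B I s) {M : Submodule K V}
    (hM : Iso B I M) : 2 * Module.finrank K M ≤ Module.finrank K V := by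
  have h1 := h.finrank_perp_add hM
  have h2 := Submodule.finrank_mono (show M ≤ perp B M from fun v hv u hu => (hM u hu).2 v hv)
  omega

/-- If every `k`-dimensional subspace contains a nonzero isotropic vector, then the maximal
totally isotropic subspaces are large. -/
theorem IsPolarForm.finrank_lt_of_maximal (h : IsPolarForm B I s) {k : ℕ}
    (hk : ∀ f : Fin k → V, LinearIndependent K f → ∃ w ∈ Submodule.span K (Set.range f),
      w ≠ 0 ∧ I w) {M : Submodule K V} (hM : Maximal (Iso B I) M) :
    Module.finrank K V < 2 * Module.finrank K M + k := by
  have h1 := h.finrank_perp_add hM.prop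
  have hle : M ≤ perp B M := fun v hv u hu => (hM.prop u hu).2 v hv
  -- A complement of `M` in its perp contains no nonzero isotropic vector, and its dimension is `dim
  -- V - 2 dim M`.
  obtain ⟨W, hW⟩ := Submodule.exists_isCompl (M.comap (perp B M).subtype)
  have h2 := Submodule.finrank_add_eq_of_isCompl hW
  rw [(Submodule.comapSubtypeEquivOfLe hle).finrank_eq] at h2
  by_contra! hcon
  obtain ⟨f, hf⟩ := exists_linearIndependent_of_le_finrank (R := K) (M := W) (n := k) (by omega)
  have hf' : LinearIndependent K fun i => ((f i : perp B M) : V) :=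
    (hf.map' W.subtype (Submodule.ker_subtype _)).map' (perp B M).subtype
      (Submodule.ker_subtype _)
  obtain ⟨w, hw, hw0, hI⟩ := hk _ hf'
  have hwW : w ∈ W.map (perp B M).subtype := by
    refine Submodule.span_le.mpr ?_ hw
    rintro _ ⟨i, rfl⟩
    exact ⟨f i, (f i).2, rfl⟩
  obtain ⟨w', hw', rfl⟩ := hwW
  have hwM : w' ∈ M.comap (perp B M).subtype := h.mem_of_perp hM hI w'.2
  have := Submodule.disjoint_def.mp hW.disjoint w' hwM hw'
  exact hw0 (by rw [this]; rfl)

end Rank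

/-! ### Alternating forms -/

section Alternating

variable {K V : Type*} [Field K] [Fintype K] [AddCommGroup V] [Module K V]

theorem isPolarForm_of_isAlt {B : LinearMap.BilinForm K V} (alt : B.IsAlt)
    (nondeg : B.Nondegenerate) :
    IsPolarForm (σ := RingHom.id K) B (fun _ => True) (Fintype.card K) where
  refl u v huv := alt.isRefl u v huv
  zero := trivial
  self u _ := alt u
  add_smul _ _ _ _ _ _ := trivial
  nondeg u _ hu := nondeg.2 u hu
  ncard_line _ _ _ _ := by
    rw [← Nat.card_eq_fintype_card, ← Set.ncard_univ]
    rfl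

end Alternating

/-! ### Quadratic forms -/

section Quadratic

variable {K V : Type*} [Field K] [Fintype K] [AddCommGroup V] [Module K V]

/-- For isotropic `p` the function `a ↦ Q (v + a p)` is affine with slope `polar Q v p ≠ 0`, whence
`s = 1`. -/
theorem isPolarForm_of_quadratic {Q : QuadraticForm K V} (nondeg : Q.Nondegenerate) :
    IsPolarForm (σ := RingHom.id K) Q.polarBilin (fun v => Q v = 0) 1 where
  refl u v huv := by
    rw [QuadraticMap.polarBilin_apply_apply] at huv ⊢
    rw [QuadraticMap.polar_comm, huv]
  zero := QuadraticMap.map_zero Q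
  self u hu := by rw [QuadraticMap.polarBilin_apply_apply, QuadraticMap.polar_self, hu, smul_zero]
  add_smul u v hu hv huv a := by
    rw [QuadraticMap.polarBilin_apply_apply] at huv
    rw [QuadraticMap.map_add Q, QuadraticMap.map_smul, QuadraticMap.polar_smul_right, hu, hv, huv]
    simp
  nondeg u hu hu' := by
    have : u ∈ Q.radical := by
      rw [QuadraticMap.mem_radical_iff']
      refine ⟨hu, fun n => ?_⟩
      have := hu' n
      rw [QuadraticMap.polarBilin_apply_apply, QuadraticMap.polar_comm] at this
      rw [QuadraticMap.map_add Q, hu, this, zero_add, add_zero]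
    rwa [nondeg.radical_eq_bot] at this
  ncard_line p v hp hvp := by
    rw [QuadraticMap.polarBilin_apply_apply] at hvp
    rw [Set.ncard_eq_one]
    refine ⟨-Q v / QuadraticMap.polar Q v p, ?_⟩
    ext a
    simp only [Set.mem_ofPred_eq, Set.mem_singleton_iff]
    rw [QuadraticMap.map_add Q, QuadraticMap.map_smul, QuadraticMap.polar_smul_right, hp,
      eq_div_iff hvp, smul_zero, add_zero, smul_eq_mul, add_comm, eq_neg_iff_add_eq_zero]

theorem iso_polarBilin_iff {Q : QuadraticForm K V} {U : Submodule K V} :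
    QuadIsotropic Q U ↔ Iso (σ := RingHom.id K) Q.polarBilin (fun v => Q v = 0) U := by
  refine ⟨fun h u hu => ⟨h u hu, fun v hv => ?_⟩, fun h u hu => (h u hu).1⟩
  rw [QuadraticMap.polarBilin_apply_apply, QuadraticMap.polar, h _ (U.add_mem hu hv), h u hu,
    h v hv, sub_zero, sub_zero]

open MvPolynomial in
/-- A quadratic form in three variables over a finite field has a nontrivial zero. -/
theorem exists_isotropic_of_quadratic (Q : QuadraticForm K V) (f : Fin 3 → V)
    (hf : LinearIndependent K f) :
    ∃ w ∈ Submodule.span K (Set.range f), w ≠ 0 ∧ Q w = 0 := by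
  classical
  obtain ⟨p, hp⟩ := CharP.exists K
  have hprime : p.Prime := (CharP.char_is_prime_or_zero K p).resolve_right
    (CharP.char_ne_zero_of_finite K p)
  let P : MvPolynomial (Fin 3) K :=
    C (Q (f 0)) * (X 0 * X 0) + C (Q (f 1)) * (X 1 * X 1) + C (Q (f 2)) * (X 2 * X 2) +
      C (QuadraticMap.polar Q (f 0) (f 1)) * (X 0 * X 1) +
      C (QuadraticMap.polar Q (f 0) (f 2)) * (X 0 * X 2) +
      C (QuadraticMap.polar Q (f 1) (f 2)) * (X 1 * X 2)
  have hmon : ∀ (c : K) (i j : Fin 3),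
      (C c * (X i * X j) : MvPolynomial (Fin 3) K).totalDegree ≤ 2 := by
    intro c i j
    refine (totalDegree_mul _ _).trans ?_
    rw [totalDegree_C, zero_add]
    refine (totalDegree_mul _ _).trans ?_
    rw [totalDegree_X, totalDegree_X]
  have hadd : ∀ a b : MvPolynomial (Fin 3) K, a.totalDegree ≤ 2 → b.totalDegree ≤ 2 →
      (a + b).totalDegree ≤ 2 :=
    fun a b ha hb => (totalDegree_add a b).trans (max_le ha hb)
  have hdeg : P.totalDegree < Fintype.card (Fin 3) := by
    rw [Fintype.card_fin, Nat.lt_succ_iff]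
    exact hadd _ _ (hadd _ _ (hadd _ _ (hadd _ _ (hadd _ _ (hmon _ _ _) (hmon _ _ _))
      (hmon _ _ _)) (hmon _ _ _)) (hmon _ _ _)) (hmon _ _ _)
  have heval : ∀ x : Fin 3 → K, eval x P = Q (∑ i, x i • f i) := by
    intro x
    rw [Fin.sum_univ_three, QuadraticMap.map_add Q, QuadraticMap.map_add Q]
    simp only [P, map_add, map_mul, eval_C, eval_X,
      QuadraticMap.map_smul, QuadraticMap.polar_add_left, QuadraticMap.polar_smul_left,
      QuadraticMap.polar_smul_right, smul_eq_mul]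
    ring
  -- Chevalley–Warning: the number of zeros is divisible by the characteristic, and the origin is
  -- already one.
  have hdvd := char_dvd_card_solutions p hdeg
  have h0 : eval 0 P = 0 := by
    rw [heval]
    simp
  have hpos : 0 < Fintype.card {x : Fin 3 → K // eval x P = 0} := Fintype.card_pos_iff.mpr ⟨0, h0⟩
  have hone : 1 < Fintype.card {x : Fin 3 → K // eval x P = 0} :=
    lt_of_lt_of_le hprime.one_lt (Nat.le_of_dvd hpos hdvd)
  obtain ⟨⟨x, hx⟩, hne⟩ := Fintype.exists_ne_of_one_lt_card hone ⟨0, h0⟩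
  refine ⟨∑ i, x i • f i, Submodule.sum_mem _ fun i _ =>
    Submodule.smul_mem _ _ (Submodule.subset_span ⟨i, rfl⟩), fun hw => hne ?_, ?_⟩
  · exact Subtype.ext (funext (Fintype.linearIndependent_iff.mp hf x hw))
  · rw [← heval]
    exact hx

end Quadratic

/-! ### Hermitian forms -/

section Hermitian

variable {K : Type*} [Field K] [Fintype K] {r : ℕ} {σ : K →+* K}

theorem two_le_of_card (card : Fintype.card K = r ^ 2) : 2 ≤ r := by
  have := Fintype.one_lt_card (α := K)
  rw [card] at this
  by_contra! h
  interval_cases r <;> simp at this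

open Polynomial in
theorem ncard_roots_le {p : K[X]} (hp : p ≠ 0) {A : Set K} (hA : ∀ a ∈ A, p.eval a = 0) :
    A.ncard ≤ p.natDegree := by
  classical
  rw [Set.ncard_eq_toFinset_card']
  refine card_le_degree_of_subset_roots fun a ha => ?_
  rw [mem_roots hp]
  exact hA a (by simpa using ha)

open Polynomial in
-- The trace `t ↦ t + σ t` has at most `r` elements in its kernel, the roots of `X^r + X`, and at
-- most `r` values, the roots of `X^r - X`. Since `|K| = r²`, both bounds are attained.
theorem ncard_trace_eq (card : Fintype.card K = r ^ 2) (frob : ∀ a, σ a = a ^ r) {c : K}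
    (hc : σ c = c) : ({t | t + σ t = c} : Set K).ncard = r := by
  have hr := two_le_of_card card
  let φ : K →+ K := AddMonoidHom.id K + σ.toAddMonoidHom
  have hφ : ∀ t, φ t = t + σ t := fun _ => rfl
  have hσσ : ∀ a, σ (σ a) = a := fun a => by
    rw [frob, frob, ← pow_mul, ← sq, ← card, FiniteField.pow_card]
  have hXr : (X : K[X]).degree < (X ^ r : K[X]).degree := by
    rw [degree_X, degree_X_pow]
    exact_mod_cast hr
  have hXr' : (X : K[X]).natDegree < (X ^ r : K[X]).natDegree := by
    rw [natDegree_X, natDegree_X_pow]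
    omega
  have hker : Nat.card φ.ker ≤ r := by
    have h1 : (X ^ r + X : K[X]) ≠ 0 := fun h => by
      have := degree_add_eq_left_of_degree_lt hXr
      rw [h, degree_zero, degree_X_pow] at this
      exact absurd this.symm (WithBot.natCast_ne_bot r)
    have h2 : (X ^ r + X : K[X]).natDegree = r := by
      rw [natDegree_add_eq_left_of_natDegree_lt hXr', natDegree_X_pow]
    rw [← h2]
    refine ncard_roots_le (A := (φ.ker : Set K)) h1 fun a ha => ?_
    have ha' : a + σ a = 0 := ha
    simpa [← frob, add_comm] using ha'
  have hfix : ({a | σ a = a} : Set K).ncard ≤ r := by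
    have h1 : (X ^ r - X : K[X]) ≠ 0 := fun h => by
      have := degree_sub_eq_left_of_degree_lt hXr
      rw [h, degree_zero, degree_X_pow] at this
      exact absurd this.symm (WithBot.natCast_ne_bot r)
    have h2 : (X ^ r - X : K[X]).natDegree = r := by
      rw [natDegree_sub_eq_left_of_natDegree_lt hXr', natDegree_X_pow]
    rw [← h2]
    refine ncard_roots_le h1 fun a ha => ?_
    have ha' : σ a = a := ha
    simp [← frob, ha']
  have hsub : (φ.range : Set K) ⊆ {a | σ a = a} := by
    rintro _ ⟨t, rfl⟩
    change σ (φ t) = φ t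
    rw [hφ, map_add, hσσ, add_comm]
  have hle : Nat.card φ.range ≤ r := (Set.ncard_le_ncard hsub (Set.toFinite _)).trans hfix
  have hmul := AddMonoidHom.natCard_ker_mul_natCard_range φ
  rw [Nat.card_eq_fintype_card (α := K), card, sq] at hmul
  have hkereq : Nat.card φ.ker = r := by
    by_contra hne
    have := Nat.mul_lt_mul_of_lt_of_le (lt_of_le_of_ne hker hne) hle (by omega)
    omega
  have hrangeeq : Nat.card φ.range = r := by
    rw [hkereq] at hmul
    exact Nat.eq_of_mul_eq_mul_left (by omega) hmul
  have heq : (φ.range : Set K) = {a | σ a = a} :=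
    Set.eq_of_subset_of_ncard_le hsub (hfix.trans hrangeeq.ge) (Set.toFinite _)
  obtain ⟨t, ht⟩ : c ∈ (φ.range : Set K) := by rw [heq]; exact hc
  rw [← hkereq, ← AddMonoidHom.ncard_fibre φ t, ht]
  rfl

/-- A nonzero fixed element satisfies `c^{r-1} = 1`, so in the cyclic group of order `(r - 1)(r +
1)` it is a power with exponent divisible by `r + 1`, that is, a norm. -/
theorem exists_norm_eq (card : Fintype.card K = r ^ 2) (frob : ∀ a, σ a = a ^ r) {c : K}
    (hc : σ c = c) : ∃ t, t * σ t = c := by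
  classical
  have hr := two_le_of_card card
  by_cases hc0 : c = 0
  · exact ⟨0, by simp [hc0]⟩
  obtain ⟨g, hg⟩ := IsCyclic.exists_generator (α := Kˣ)
  have hord : orderOf g = (r - 1) * (r + 1) := by
    rw [orderOf_eq_card_of_forall_mem_zpowers hg, Nat.card_eq_fintype_card, Fintype.card_units,
      card, mul_comm, ← Nat.sq_sub_sq, one_pow]
  obtain ⟨k, hk⟩ := (mem_powers_iff_mem_zpowers (x := g) (y := Units.mk0 c hc0)).mpr (hg _)
  have hk' : g ^ k = Units.mk0 c hc0 := hk
  have h1 : g ^ (k * (r - 1)) = 1 := by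
    rw [pow_mul, hk']
    ext
    simp only [Units.val_pow_eq_pow_val, Units.val_mk0, Units.val_one]
    apply mul_right_cancel₀ hc0
    rw [← pow_succ, Nat.sub_add_cancel (by omega), ← frob, hc, one_mul]
  have h2 := orderOf_dvd_of_pow_eq_one h1
  rw [hord, mul_comm k] at h2
  obtain ⟨l, rfl⟩ := Nat.dvd_of_mul_dvd_mul_left (by omega) h2
  refine ⟨((g ^ l : Kˣ) : K), ?_⟩
  rw [frob, ← pow_succ', ← Units.val_pow_eq_pow_val, ← pow_mul, mul_comm l, hk', Units.val_mk0]

variable {V : Type*} [AddCommGroup V] [Module K V] {H : V →ₛₗ[σ] V →ₗ[K] K}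

/-- The condition that `v + a p` be isotropic says that `a * H v p` has trace `-H v v`, whence `s =
r`. -/
theorem isPolarForm_of_hermitian (card : Fintype.card K = r ^ 2) (frob : ∀ a, σ a = a ^ r)
    (herm : ∀ u v, H v u = σ (H u v)) (nondeg : H.Nondegenerate) :
    IsPolarForm H (fun v => H v v = 0) r where
  refl u v huv := by rw [herm, huv, map_zero]
  zero := by simp
  self u hu := hu
  add_smul u v hu hv huv a := by
    have hvu : H v u = 0 := by rw [herm, huv, map_zero]
    simp [hu, hv, huv, hvu]
  nondeg u _ hu := nondeg.2 u hu
  ncard_line p v hp hvp := by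
    have hc : σ (-H v v) = -H v v := by rw [map_neg, ← herm]
    rw [← ncard_trace_eq card frob hc,
      ← Set.ncard_image_of_injective _ (mul_left_injective₀ hvp)]
    congr 1
    have key : ∀ a, H (v + a • p) (v + a • p) = H v v + (a * H v p + σ (a * H v p)) := by
      intro a
      rw [map_mul, ← herm v p]
      simp [hp]
      ring
    ext t
    constructor
    · rintro ⟨a, ha, rfl⟩
      have ha' : H (v + a • p) (v + a • p) = 0 := ha
      rw [key] at ha'
      exact eq_neg_of_add_eq_zero_right ha'
    · intro ht
      have ht' : t + σ t = -H v v := ht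
      refine ⟨t / H v p, ?_, div_mul_cancel₀ _ hvp⟩
      change H (v + (t / H v p) • p) (v + (t / H v p) • p) = 0
      rw [key, div_mul_cancel₀ _ hvp, ht', add_neg_cancel]

theorem exists_isotropic_of_hermitian (card : Fintype.card K = r ^ 2) (frob : ∀ a, σ a = a ^ r)
    (herm : ∀ u v, H v u = σ (H u v)) (f : Fin 2 → V) (hf : LinearIndependent K f) :
    ∃ w ∈ Submodule.span K (Set.range f), w ≠ 0 ∧ H w w = 0 := by
  have hmem : ∀ i, f i ∈ Submodule.span K (Set.range f) := fun i => Submodule.subset_span ⟨i, rfl⟩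
  by_cases h0 : H (f 0) (f 0) = 0
  · exact ⟨f 0, hmem 0, hf.ne_zero 0, h0⟩
  have hne : ∀ a : K, f 1 + a • f 0 ≠ 0 := by
    intro a ha
    have := Fintype.linearIndependent_iff.mp hf ![a, 1]
      (by rw [Fin.sum_univ_two]; simpa [add_comm] using ha) 1
    simp at this
  -- Gram–Schmidt makes `v` orthogonal to `f 0`; then `v + t f 0` is isotropic once the norm of `t`
  -- is `-H v v / H (f 0) (f 0)`.
  set b := -(H (f 0) (f 1) / H (f 0) (f 0)) with hb
  set v := f 1 + b • f 0 with hv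
  have hv0 : H (f 0) v = 0 := by
    rw [hv, map_add, map_smul, smul_eq_mul, hb, neg_mul, div_mul_cancel₀ _ h0, add_neg_cancel]
  have hv0' : H v (f 0) = 0 := by rw [herm, hv0, map_zero]
  have hfix : σ (-(H v v / H (f 0) (f 0))) = -(H v v / H (f 0) (f 0)) := by
    rw [map_neg, map_div₀, ← herm, ← herm]
  obtain ⟨t, ht⟩ := exists_norm_eq card frob hfix
  refine ⟨f 1 + (b + t) • f 0, add_mem (hmem 1) (Submodule.smul_mem _ _ (hmem 0)), hne _, ?_⟩
  have e : f 1 + (b + t) • f 0 = v + t • f 0 := by rw [hv, add_smul, add_assoc]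
  have e' : H (v + t • f 0) (v + t • f 0) = H v v + t * σ t * H (f 0) (f 0) := by
    simp [hv0, hv0']
    ring
  rw [e, e', ht, neg_mul, div_mul_cancel₀ _ h0, add_neg_cancel]

end Hermitian

/-! ### The six families -/

section Families

theorem rp_one (q : ℕ) : rp q 1 = q := by simpa using rp_natCast (q := q) 1

theorem rp_sq_half (r : ℕ) : rp (r ^ 2) (1 / 2) = r := by
  unfold rp
  rw [Nat.cast_pow, ← Real.sqrt_eq_rpow, Real.sqrt_sq (Nat.cast_nonneg r)]
  simp

theorem rp_sq_three_halves {r : ℕ} (hr : 0 < r) : rp (r ^ 2) (3 / 2) = (r : ℂ) * r ^ 2 := by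
  rw [show (3 / 2 : ℝ) = 1 / 2 + 1 by norm_num, rp_add (pow_pos hr 2), rp_sq_half, rp_one]
  push_cast
  rfl

end Families

end DualPolar

end

/-! ### The main theorem, family by family -/

theorem theorem7p13 {K V : Type*} [Field K] [Fintype K] [AddCommGroup V] [Module K V]
    [Module.Finite K V] {D : ℕ} (hD : 3 ≤ D) (S : DualPolar.PolarSpace K V D)
    (x : S.Vertex) (C : Set S.Vertex) (hC : Maximal S.graph.IsClique C) (hx : x ∈ C) :
    LinearIndependent ℂ (DualPolar.cellVec S.graph x C D) ∧
    DualPolar.boseMesnerSpan S.graph (DualPolar.charVec {x}) ≤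
      DualPolar.primaryW S.graph x C D ∧
    DualPolar.boseMesnerSpan S.graph (DualPolar.charVec C) ≤
      DualPolar.primaryW S.graph x C D ∧
    ∃ ρ : DualPolar.NilDAHA (DualPolar.kappa (Fintype.card K) S.e)
        (DualPolar.kappa' (Fintype.card K) D) →ₐ[ℂ]
        Module.End ℂ (DualPolar.primaryW S.graph x C D),
      DualPolar.IsNilAction (DualPolar.cellVec S.graph x C D) ρ ∧
      (∀ ρ', DualPolar.IsNilAction (DualPolar.cellVec S.graph x C D) ρ' → ρ' = ρ) ∧
      DualPolar.orthProjOn (DualPolar.primaryW S.graph x C D)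
          (DualPolar.boseMesnerSpan S.graph (DualPolar.charVec {x})) =
        (DualPolar.kappa' (Fintype.card K) D + (DualPolar.kappa' (Fintype.card K) D)⁻¹)⁻¹ •
          (ρ (DualPolar.NilDAHA.T' _ _) +
            (DualPolar.kappa' (Fintype.card K) D)⁻¹ • LinearMap.id) ∧
      DualPolar.orthProjOn (DualPolar.primaryW S.graph x C D)
          (DualPolar.boseMesnerSpan S.graph (DualPolar.charVec C)) =
        (DualPolar.kappa (Fintype.card K) S.e + (DualPolar.kappa (Fintype.card K) S.e)⁻¹)⁻¹ •
          (ρ (DualPolar.NilDAHA.T _ _) +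
            (DualPolar.kappa (Fintype.card K) S.e)⁻¹ • LinearMap.id) := by
  open DualPolar in
  have witt : ∀ {Q : QuadraticForm K V}, Q.Nondegenerate → QuadHasWittIndex Q D →
      ∀ M, Maximal (Iso (σ := RingHom.id K) Q.polarBilin (fun v => Q v = 0)) M →
        Module.finrank K M = D := by
    intro Q nondeg witt M hM
    obtain ⟨U, hU, hr⟩ := witt.1
    refine le_antisymm (witt.2 ⟨M, iso_polarBilin_iff.mpr hM.prop, rfl⟩) ?_
    rw [← hr]
    exact (isPolarForm_of_quadratic nondeg).finrank_le_of_maximal hM (iso_polarBilin_iff.mp hU)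
  cases S with
  | symplectic B alt nondeg dim =>
    have form := DualPolar.isPolarForm_of_isAlt alt nondeg
    refine DualPolar.nilDAHA_action_of_isModel (σ := RingHom.id K) (B := B)
      ⟨form, fun U => ?_, fun M hM => ?_, dim.ge, Fintype.card_pos, by omega⟩ ?_ x C hC hx
    · exact ⟨fun h u hu => ⟨trivial, h u hu⟩, fun h u hu => (h u hu).2⟩
    -- Every nonzero vector is isotropic, so `k = 1` and `2 dim M ≤ 2 D < 2 dim M + 1`. The families
    -- without a Witt index hypothesis are treated alike, with `k = 3` for quadratic and `k = 2` for
    -- Hermitian forms.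
    · have h1 := form.two_mul_finrank_le hM.prop
      have h2 := form.finrank_lt_of_maximal (k := 1)
        (fun f hf => ⟨f 0, Submodule.subset_span ⟨0, rfl⟩, hf.ne_zero 0, trivial⟩) hM
      omega
    -- Here `s q^{n-2D} = q^e` is checked: `q` in types C and B, and below `1` and `q²` for the
    -- other quadratic families, `r q` and `r` for the Hermitian ones.
    · rw [dim]
      simpa [DualPolar.PolarSpace.e] using DualPolar.rp_one _
  | parabolic Q nondeg dim =>
    have form := DualPolar.isPolarForm_of_quadratic nondeg
    refine DualPolar.nilDAHA_action_of_isModel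
      ⟨form, fun U => by exact DualPolar.iso_polarBilin_iff, fun M hM => ?_, by omega, le_rfl, by omega⟩
      ?_ x C hC hx
    · have h1 := form.two_mul_finrank_le hM.prop
      have h2 := form.finrank_lt_of_maximal (DualPolar.exists_isotropic_of_quadratic Q) hM
      omega
    · rw [dim]
      simpa [DualPolar.PolarSpace.e] using DualPolar.rp_one _
  | hyperbolic Q nondeg dim hw =>
    refine DualPolar.nilDAHA_action_of_isModel
      ⟨DualPolar.isPolarForm_of_quadratic nondeg, fun U => by exact DualPolar.iso_polarBilin_iff,
        witt nondeg hw, by omega, le_rfl, by omega⟩ ?_ x C hC hx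
    rw [dim]
    simp [DualPolar.PolarSpace.e, DualPolar.rp]
  | elliptic Q nondeg dim hw =>
    refine DualPolar.nilDAHA_action_of_isModel
      ⟨DualPolar.isPolarForm_of_quadratic nondeg, fun U => by exact DualPolar.iso_polarBilin_iff,
        witt nondeg hw, by omega, le_rfl, by omega⟩ ?_ x C hC hx
    rw [dim, Nat.add_sub_cancel_left]
    simpa [DualPolar.PolarSpace.e] using DualPolar.rp_natCast (q := Fintype.card K) 2
  | hermitianOdd r card σ frob H herm nondeg dim =>
    have form := DualPolar.isPolarForm_of_hermitian card frob herm nondeg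
    have hr := DualPolar.two_le_of_card card
    refine DualPolar.nilDAHA_action_of_isModel
      ⟨form, fun U => ?_, fun M hM => ?_, by omega, by omega, by omega⟩ ?_ x C hC hx
    · exact ⟨fun h u hu => ⟨h u hu u hu, h u hu⟩, fun h u hu => (h u hu).2⟩
    · have h1 := form.two_mul_finrank_le hM.prop
      have h2 := form.finrank_lt_of_maximal
        (DualPolar.exists_isotropic_of_hermitian card frob herm) hM
      omega
    · rw [dim, card]
      simpa [DualPolar.PolarSpace.e] using DualPolar.rp_sq_three_halves (by omega : 0 < r)
  | hermitianEven r card σ frob H herm nondeg dim =>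
    have form := DualPolar.isPolarForm_of_hermitian card frob herm nondeg
    have hr := DualPolar.two_le_of_card card
    refine DualPolar.nilDAHA_action_of_isModel
      ⟨form, fun U => ?_, fun M hM => ?_, by omega, by omega, by omega⟩ ?_ x C hC hx
    · exact ⟨fun h u hu => ⟨h u hu u hu, h u hu⟩, fun h u hu => (h u hu).2⟩
    · have h1 := form.two_mul_finrank_le hM.prop
      have h2 := form.finrank_lt_of_maximal
        (DualPolar.exists_isotropic_of_hermitian card frob herm) hM
      omega
    · rw [dim, card]
      simpa [DualPolar.PolarSpace.e] using DualPolar.rp_sq_half r
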